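/- Theorem 1.2. Let $t>0$ and $0<\alpha\le 2$. Let $\Delta_\alpha=\{z\in\mathbb{C}\setminus\{0\}:|\arg z|<\pi\alpha/4\}$, let $dA$ be Lebesgue measure, let all complex powers be principal branches, and let $B$ be the Beta function. For $g\in L^2_{\mathbb{C}}((0,t),\tau^\alpha d\tau/t^\alpha)$ and $z\in\Delta_\alpha$ put $$\mathcal{L}_t^{\alpha}g(z)=\frac{(\alpha/2)^\alpha}{\Gamma(\alpha/2)\,t^{\alpha}}\int_0^t\frac{z}{(t-\tau)^{\alpha/2+1}}\exp\left(-\frac{\alpha^2z^{2/\alpha}}{4(t-\tau)}\right)g(\tau)\,\tau^{\alpha}\,d\tau .$$ Let $A^2_{\alpha-1}(\Delta_\alpha)$ be the space of all holomorphic $f$ on $\Delta_\alpha$ with $\int_{\Delta_\alpha}|f(z)|^2(\Re z^{2/\alpha})^{\alpha-1}|z|^{(\alpha-2)(\alpha-1)/\alpha}dA(z)<\infty$, with the inner product $$\langle f,h\rangle=(\alpha\pi^{1/2})^{\alpha-1}\int_{\Delta_\alpha}f(z)\overline{h(z)}\,(\Re z^{2/\alpha})^{\alpha-1}|z|^{(\alpha-2)(\alpha-1)/\alpha}dA(z),$$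 and let $\mathcal{G}_\alpha^t=z^{(\alpha-1)(\alpha+2)/(2\alpha)}e^{-\frac{\alpha^2}{4t}z^{2/\alpha}}A^2_{\alpha-1}(\Delta_\alpha)$ with the norm $$\|F\|_{\mathcal{G}_\alpha^t}=\frac{B(\alpha/2,\alpha/2)^{1/2}}{(\alpha/2)^{(\alpha-1)/2}\pi^{(\alpha+1)/4}}\left\|z^{(1-\alpha)(\alpha+2)/(2\alpha)}e^{\frac{\alpha^2}{4t}z^{2/\alpha}}F\right\|_{A^2_{\alpha-1}(\Delta_\alpha)} .$$ Then the integral defining $\mathcal{L}_t^{\alpha}g(z)$ converges absolutely, and $\mathcal{L}_t^{\alpha}$ is an isometric linear isomorphism of $L^2_{\mathbb{C}}((0,t),\tau^\alpha d\tau/t^\alpha)$ onto $\mathcal{G}_\alpha^t$. Furthermore, let $$d\mu_\alpha^t(z)=\pi^{-1}2^{\alpha-1}B(\alpha/2,\alpha/2)\,|z|^{4(1-\alpha)/\alpha}e^{\frac{\alpha^2}{2t}\Re(z^{2/\alpha})}(\Re z^{2/\alpha})^{\alpha-1}dA(z),\qquad z\in\Delta_\alpha,$$ and let $(E_N)$ be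 any compact exhaustion of $\Delta_\alpha$ (an increasing sequence of compact sets with union $\Delta_\alpha$). Then for every $F\in\mathcal{G}_\alpha^t$ the functions $$\tau\mapsto\frac{(\alpha/2)^\alpha}{\Gamma(\alpha/2)(t-\tau)^{\alpha/2+1}}\int_{E_N}\overline{z}F(z)\exp\left(-\frac{\alpha^2\,\overline{z}^{\,2/\alpha}}{4(t-\tau)}\right)d\mu_\alpha^t(z)$$ are well defined (the integrals converge absolutely for all $\tau\in(0,t)$), belong to $L^2((0,t),\tau^\alpha d\tau/t^\alpha)$, and converge in that space to $(\mathcal{L}_t^{\alpha})^{-1}F$ as $N\to\infty$. -/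

import Mathlib

open MeasureTheory Filter Topology

noncomputable section

/-- The open sector `Δ_α = {z ≠ 0 : |arg z| < π α / 4}` (symmetric about the positive real axis). -/
def sector (α : ℝ) : Set ℂ :=
  {z | z ≠ 0 ∧ |Complex.arg z| < Real.pi * α / 4}

/-- The real part of `z ^ (2 / α)` (principal branch); it is positive on `Δ_α` for `0 < α ≤ 2`. -/
def rePow (α : ℝ) (z : ℂ) : ℝ :=
  (z ^ ((2 / α : ℝ) : ℂ)).re

/-- The measure `τ ^ α dτ / t ^ α` on the interval `(0, t)`. -/
def dataMeasure (α t : ℝ) : Measure ℝ :=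
  (volume.restrict (Set.Ioo 0 t)).withDensity fun τ => ENNReal.ofReal (τ ^ α / t ^ α)

/-- The integrand `z (t - τ) ^ (-(α/2 + 1)) exp (-α² z ^ (2/α) / (4 (t - τ))) g(τ) τ ^ α`
of the operator `L_t^α`. -/
def operatorIntegrand (α t : ℝ) (g : ℝ → ℂ) (z : ℂ) (τ : ℝ) : ℂ :=
  z / (((t - τ) ^ (α / 2 + 1) : ℝ) : ℂ) *
    Complex.exp (-((α : ℂ) ^ 2 * z ^ ((2 / α : ℝ) : ℂ)) / (4 * ((t : ℂ) - (τ : ℂ)))) *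
    g τ * ((τ ^ α : ℝ) : ℂ)

/-- The operator `L_t^α`: for `g` on `(0, t)` it gives the function
`z ↦ (α/2)^α / (Γ(α/2) t^α) ∫_0^t z (t-τ)^(-(α/2+1)) exp (-α² z^(2/α) / (4(t-τ))) g(τ) τ^α dτ`
on the sector `Δ_α`. -/
def sectorOperator (α t : ℝ) (g : ℝ → ℂ) (z : sector α) : ℂ :=
  (((α / 2) ^ α / (Real.Gamma (α / 2) * t ^ α) : ℝ) : ℂ) *
    ∫ τ in Set.Ioo 0 t, operatorIntegrand α t g z τ

/-- The area (Lebesgue) measure `dA` on the sector `Δ_α`. -/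
def areaMeasure (α : ℝ) : Measure (sector α) :=
  (volume : Measure ℂ).comap Subtype.val

/-- A function on the sector `Δ_α` is holomorphic. -/
def HolomorphicOnSector (α : ℝ) (f : sector α → ℂ) : Prop :=
  ∃ h : ℂ → ℂ, DifferentiableOn ℂ h (sector α) ∧ ∀ z : sector α, f z = h z

/-- The weight `(Re z^(2/α))^(α-1) |z|^((α-2)(α-1)/α)`. -/
def bergmanWeight (α : ℝ) (z : ℂ) : ℝ :=
  rePow α z ^ (α - 1) * ‖z‖ ^ ((α - 2) * (α - 1) / α)

lemma HolomorphicOnSector.continuous {α : ℝ} {f : sector α → ℂ}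
    (hf : HolomorphicOnSector α f) : Continuous f := by
  obtain ⟨h, hh, hfh⟩ := hf
  have : f = (sector α).domRestrict h := funext hfh
  rw [this]
  exact continuousOn_iff_continuous_domRestrict.1 hh.continuousOn

lemma measurable_rePow (α : ℝ) : Measurable (rePow α) := by
  unfold rePow
  fun_prop

lemma measurable_bergmanWeight (α : ℝ) : Measurable (bergmanWeight α) := by
  have := measurable_rePow α
  unfold bergmanWeight
  fun_prop

/-- The weighted Bergman space `A²_{α-1}(Δ_α)`: the holomorphic functions `f` on `Δ_α` with
`∫ |f(z)|² (Re z^(2/α))^(α-1) |z|^((α-2)(α-1)/α) dA(z) < ∞`. -/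
def bergmanSpace (α : ℝ) : Submodule ℂ (sector α → ℂ) where
  carrier := {f | HolomorphicOnSector α f ∧
    Integrable (fun z : sector α => ‖f z‖ ^ 2 * bergmanWeight α z) (areaMeasure α)}
  zero_mem' := ⟨⟨0, differentiableOn_const 0, fun _ => rfl⟩, by simp⟩
  add_mem' := by
    rintro f g ⟨hf, hfi⟩ ⟨hg, hgi⟩
    refine ⟨?_, ?_⟩
    · obtain ⟨F, hF, hfF⟩ := hf
      obtain ⟨G, hG, hgG⟩ := hg
      exact ⟨F + G, hF.add hG, fun z => by simp [hfF, hgG]⟩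
    · have hw : Measurable fun z : sector α => bergmanWeight α z :=
        (measurable_bergmanWeight α).comp measurable_subtype_coe
      refine ((hfi.norm.const_mul 2).add (hgi.norm.const_mul 2)).mono' ?_ (.of_forall fun z => ?_)
      · exact (((hf.continuous.add hg.continuous).norm.pow 2).measurable.mul
          hw).aestronglyMeasurable
      · have h1 : ‖(f + g) z‖ ^ 2 ≤ 2 * ‖f z‖ ^ 2 + 2 * ‖g z‖ ^ 2 := by
          have h2 : ‖(f + g) z‖ ≤ ‖f z‖ + ‖g z‖ := norm_add_le (f z) (g z)
          nlinarith [sq_nonneg (‖f z‖ - ‖g z‖), norm_nonneg ((f + g) z)]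
        have h3 := mul_le_mul_of_nonneg_right h1 (norm_nonneg (bergmanWeight α z))
        simp only [Pi.add_apply, norm_mul, norm_pow, norm_norm] at h3 ⊢
        linarith
  smul_mem' := by
    rintro c f ⟨hf, hfi⟩
    refine ⟨?_, ?_⟩
    · obtain ⟨F, hF, hfF⟩ := hf
      exact ⟨c • F, hF.const_smul c, fun z => by simp [hfF]⟩
    · refine (hfi.const_mul (‖c‖ ^ 2)).congr (.of_forall fun z => ?_)
      simp [mul_pow, mul_assoc]

/-- The inner product of `A²_{α-1}(Δ_α)`:
`⟨f, g⟩ = (α π^(1/2))^(α-1) ∫ f(z) conj(g(z)) (Re z^(2/α))^(α-1) |z|^((α-2)(α-1)/α) dA(z)`. -/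
def bergmanInner (α : ℝ) (f g : sector α → ℂ) : ℂ :=
  (((α * Real.pi ^ (1 / 2 : ℝ)) ^ (α - 1) : ℝ) : ℂ) *
    ∫ z : sector α, f z * (starRingEnd ℂ) (g z) * ((bergmanWeight α z : ℝ) : ℂ) ∂(areaMeasure α)

/-- The norm of `A²_{α-1}(Δ_α)`. -/
def bergmanNorm (α : ℝ) (f : sector α → ℂ) : ℝ :=
  Real.sqrt (bergmanInner α f f).re

/-- The multiplier `z^((α-1)(α+2)/(2α)) exp (-α² z^(2/α) / (4t))` on `Δ_α`. -/
def imageMultiplier (α t : ℝ) (z : sector α) : ℂ :=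
  (z : ℂ) ^ (((α - 1) * (α + 2) / (2 * α) : ℝ) : ℂ) *
    Complex.exp (-((α : ℂ) ^ 2 / (4 * (t : ℂ))) * (z : ℂ) ^ ((2 / α : ℝ) : ℂ))

/-- The space `𝒢_α^t = z^((α-1)(α+2)/(2α)) exp (-α² z^(2/α) / (4t)) A²_{α-1}(Δ_α)`. -/
def imageSpace (α t : ℝ) : Submodule ℂ (sector α → ℂ) :=
  (bergmanSpace α).map (LinearMap.mulLeft ℂ (imageMultiplier α t))

/-- The norm of `𝒢_α^t`:
`‖F‖ = B(α/2, α/2)^(1/2) / ((α/2)^((α-1)/2) π^((α+1)/4))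
  * ‖z^((1-α)(α+2)/(2α)) exp (α² z^(2/α) / (4t)) F‖`, the norm on the right being that of
`A²_{α-1}(Δ_α)`. -/
def imageNorm (α t : ℝ) (F : sector α → ℂ) : ℝ :=
  ProbabilityTheory.beta (α / 2) (α / 2) ^ (1 / 2 : ℝ) /
      ((α / 2) ^ ((α - 1) / 2) * Real.pi ^ ((α + 1) / 4)) *
    bergmanNorm α fun z =>
      (z : ℂ) ^ (((1 - α) * (α + 2) / (2 * α) : ℝ) : ℂ) *
        Complex.exp (((α : ℂ) ^ 2 / (4 * (t : ℂ))) * (z : ℂ) ^ ((2 / α : ℝ) : ℂ)) * F z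

/-- The measure `dμ_α^t(z) = π⁻¹ 2^(α-1) B(α/2, α/2) |z|^(4(1-α)/α) exp (α² Re(z^(2/α)) / (2t))
(Re z^(2/α))^(α-1) dA(z)` on `Δ_α`. -/
def sectorMeasure (α t : ℝ) : Measure (sector α) :=
  (areaMeasure α).withDensity fun z =>
    ENNReal.ofReal (Real.pi⁻¹ * 2 ^ (α - 1) * ProbabilityTheory.beta (α / 2) (α / 2) *
      ‖(z : ℂ)‖ ^ (4 * (1 - α) / α) * Real.exp (α ^ 2 / (2 * t) * rePow α z) *
      rePow α z ^ (α - 1))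

/-- The integrand `conj(z) F(z) exp (-α² conj(z)^(2/α) / (4 (t - τ)))` of the inverse formula. -/
def inverseIntegrand (α t : ℝ) (F : sector α → ℂ) (τ : ℝ) (z : sector α) : ℂ :=
  (starRingEnd ℂ) (z : ℂ) * F z *
    Complex.exp (-((α : ℂ) ^ 2 * ((starRingEnd ℂ) (z : ℂ)) ^ ((2 / α : ℝ) : ℂ)) /
      (4 * ((t : ℂ) - (τ : ℂ))))

/-- The truncated inverse transform, over a subset `E` of `Δ_α`:
`τ ↦ (α/2)^α / (Γ(α/2) (t-τ)^(α/2+1)) ∫_E conj(z) F(z) exp (-α² conj(z)^(2/α) / (4(t-τ))) dμ_α^t(z)`.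
-/
def truncatedInverse (α t : ℝ) (F : sector α → ℂ) (E : Set (sector α)) (τ : ℝ) : ℂ :=
  (((α / 2) ^ α / (Real.Gamma (α / 2) * (t - τ) ^ (α / 2 + 1)) : ℝ) : ℂ) *
    ∫ z in E, inverseIntegrand α t F τ z ∂(sectorMeasure α t)

end

/-! The operator is the transform `g ↦ ⟪k z, g⟫` attached to a feature map `k` from the sector into
the data space, where `k z` is the conjugate of the integral kernel. Everything follows from
comparing its Gram kernel `⟪k z, k z₀⟫` with the reproducing kernel of the target.

The target is concrete: the multiplier squared times the density of `sectorMeasure` is a constant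
times the Bergman weight, and the normalizing constants agree. Hence the image space is the space of
holomorphic functions in `L²(sectorMeasure)`, with the `L²` norm (`mem_imageSpace_iff`,
`imageNorm_eq_sqrt_integral`).

Its reproducing kernel is `sectorKernel` (`sector_reproducing`). The substitution `z = w ^ (α/2)`
leads to a weighted Bergman space of the right half-plane. A Cayley transform sending `0` to the
evaluation point leads on to the disc, where reproduction is the mean value property against a
radial weight (`halfPlane_reproducing`).

The Gram kernel is the same function (`inner_featureMap_featureMap`): the substitution `s = 1/(t-τ)
- 1/t` turns the inner product into the Laplace transform of `s ^ α`. The vectors `k z` are total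
(`span_featureMap_dense`), because orthogonality to those with `z ^ (2/α) = 1 + i x` makes a Fourier
transform vanish.

These facts give an isometry `U` into `L²(sectorMeasure)` (`exists_linearIsometry_of_reproducing`).
Since every `F` in the target is reproduced, `⟪k z, U* F⟫ = F z`, so the transform is onto with
inverse `U*` (`inner_adjoint_eq_of_reproducing`). By Fubini the truncated inversion integral is `U*`
applied to `F` cut off to `E_N`, and continuity of `U*` gives the limit (`toLp_truncatedInverse`).
-/

open scoped ComplexConjugate InnerProductSpace

/-! ### Feature maps and reproducing kernels -/

/-- If the kernel functions `K_x = ⟪k ·, k x⟫` of a feature map `k` with total range are square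
integrable and reproduce each other, then `g ↦ ⟪k ·, g⟫` is an isometry into `L²`. -/
theorem exists_linearIsometry_of_reproducing {X H : Type*} [MeasurableSpace X] {μ : Measure X}
    [NormedAddCommGroup H] [InnerProductSpace ℂ H] (k : X → H)
    (hmem : ∀ x, MemLp (fun y => ⟪k y, k x⟫_ℂ) 2 μ)
    (hrep : ∀ x x', ∫ y, ⟪k y, k x⟫_ℂ * conj ⟪k y, k x'⟫_ℂ ∂μ = ⟪k x', k x⟫_ℂ)
    (htot : Dense (Submodule.span ℂ (Set.range k) : Set H)) :
    ∃ U : H →ₗᵢ[ℂ] Lp ℂ 2 μ, ∀ g, U g =ᵐ[μ] fun y => ⟪k y, g⟫_ℂ := by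
  have hspan : ∀ g ∈ Submodule.span ℂ (Set.range k), MemLp (fun y => ⟪k y, g⟫_ℂ) 2 μ := by
    intro g hg
    induction hg using Submodule.span_induction with
    | mem x hx => obtain ⟨x, rfl⟩ := hx; exact hmem x
    | zero => simp
    | add x y _ _ hx hy => simp only [inner_add_right]; exact hx.add hy
    | smul c x _ hx => simpa only [inner_smul_right, smul_eq_mul] using hx.const_mul c
  have hprod : ∀ g ∈ Submodule.span ℂ (Set.range k), ∀ g' ∈ Submodule.span ℂ (Set.range k),
      ∫ y, ⟪k y, g⟫_ℂ * conj ⟪k y, g'⟫_ℂ ∂μ = ⟪g', g⟫_ℂ := by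
    have hint : ∀ g ∈ Submodule.span ℂ (Set.range k), ∀ g' ∈ Submodule.span ℂ (Set.range k),
        Integrable (fun y => ⟪k y, g⟫_ℂ * conj ⟪k y, g'⟫_ℂ) μ := fun g hg g' hg' =>
      (hspan g hg).integrable_mul (hspan g' hg').star
    intro g hg g' hg'
    induction hg, hg' using Submodule.span_induction₂ with
    | mem_mem x y hx hy =>
      obtain ⟨x, rfl⟩ := hx
      obtain ⟨y, rfl⟩ := hy
      exact hrep x y
    | zero_left => simp
    | zero_right => simp
    | add_left x y z hx hy hz h1 h2 =>
      simp only [inner_add_right, add_mul]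
      rw [integral_add (hint x hx z hz) (hint y hy z hz), h1, h2]
    | add_right x y z hx hy hz h1 h2 =>
      simp only [inner_add_right, map_add, mul_add, inner_add_left]
      rw [integral_add (hint x hx y hy) (hint x hx z hz), h1, h2]
    | smul_left r x y hx hy h =>
      simp only [inner_smul_right, mul_assoc]
      rw [integral_const_mul, h]
    | smul_right r x y hx hy h =>
      simp only [inner_smul_right, inner_smul_left, map_mul, mul_left_comm _ (conj r)]
      rw [integral_const_mul, h]
  have hnorm : ∀ g ∈ Submodule.span ℂ (Set.range k),
      eLpNorm (fun y => ⟪k y, g⟫_ℂ) 2 μ = ‖g‖ₑ := by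
    intro g hg
    have h1 : ‖(hspan g hg).toLp‖ = ‖g‖ := by
      have h2 : ⟪(hspan g hg).toLp, (hspan g hg).toLp⟫_ℂ = ⟪g, g⟫_ℂ := by
        rw [L2.inner_def, ← hprod g hg g hg]
        refine integral_congr_ae ?_
        filter_upwards [(hspan g hg).coeFn_toLp] with y hy
        rw [hy, RCLike.inner_apply]
      rw [inner_self_eq_norm_sq_to_K, inner_self_eq_norm_sq_to_K] at h2
      exact (sq_eq_sq₀ (norm_nonneg _) (norm_nonneg _)).1 (by exact_mod_cast h2)
    rw [← ofReal_norm, ← h1, Lp.norm_toLp, ENNReal.ofReal_toReal (hspan g hg).2.ne]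
  -- Nothing is assumed about measurability of `k`. For general `g` the transform is a pointwise
  -- limit of transforms of vectors in the span, so it is measurable, and Fatou bounds its norm.
  have hle : ∀ g, AEStronglyMeasurable (fun y => ⟪k y, g⟫_ℂ) μ ∧
      eLpNorm (fun y => ⟪k y, g⟫_ℂ) 2 μ ≤ ‖g‖ₑ := by
    intro g
    obtain ⟨u, hu, hug⟩ := mem_closure_iff_seq_limit.1 (htot g)
    have hlim : ∀ y, Tendsto (fun n => ⟪k y, u n⟫_ℂ) atTop (𝓝 ⟪k y, g⟫_ℂ) := fun y =>
      tendsto_const_nhds.inner hug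
    refine ⟨aestronglyMeasurable_of_tendsto_ae atTop (fun n => (hspan _ (hu n)).1)
      (.of_forall hlim), ?_⟩
    refine (Lp.eLpNorm_lim_le_liminf_eLpNorm (fun n => (hspan _ (hu n)).1) _
      (.of_forall hlim)).trans_eq ?_
    simp_rw [fun n => hnorm _ (hu n)]
    exact (hug.enorm).liminf_eq
  have hall : ∀ g, MemLp (fun y => ⟪k y, g⟫_ℂ) 2 μ := fun g =>
    ⟨(hle g).1, (hle g).2.trans_lt enorm_lt_top⟩
  let U₀ : H →ₗ[ℂ] Lp ℂ 2 μ :=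
    { toFun := fun g => (hall g).toLp
      map_add' := fun x y => by
        rw [← MemLp.toLp_add]
        exact MemLp.toLp_congr _ _ (.of_forall fun z => inner_add_right _ _ _)
      map_smul' := fun c x => by
        rw [RingHom.id_apply, ← MemLp.toLp_const_smul]
        exact MemLp.toLp_congr _ _ (.of_forall fun z => inner_smul_right _ _ _) }
  have hU₀ : ∀ g, ‖U₀ g‖ = (eLpNorm (fun y => ⟪k y, g⟫_ℂ) 2 μ).toReal := fun g =>
    Lp.norm_toLp _ (hall g)
  have hbound : ∀ g, ‖U₀ g‖ ≤ 1 * ‖g‖ := fun g => by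
    rw [hU₀, one_mul, ← toReal_enorm g]
    exact ENNReal.toReal_mono enorm_ne_top (hle g).2
  let U₁ : H →L[ℂ] Lp ℂ 2 μ := U₀.mkContinuous 1 hbound
  -- Fatou gives only an inequality; equality extends from the dense span by continuity of both
  -- norms.
  have hU₁ : ∀ g, ‖U₁ g‖ = ‖g‖ := by
    have : (fun g => ‖U₁ g‖) = fun g => ‖g‖ := by
      refine Continuous.ext_on htot (by fun_prop) (by fun_prop) fun g hg => ?_
      change ‖U₀ g‖ = _
      rw [hU₀, hnorm g hg, toReal_enorm]
    exact fun g => congrFun this g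
  exact ⟨⟨U₁.toLinearMap, hU₁⟩, fun g => (hall g).coeFn_toLp⟩

/-- A function that is reproduced by the kernel lies in the range of the isometry; its preimage is
given by the adjoint. -/
theorem inner_adjoint_eq_of_reproducing {X H : Type*} [MeasurableSpace X] {μ : Measure X}
    [NormedAddCommGroup H] [InnerProductSpace ℂ H] [CompleteSpace H] (k : X → H)
    (U : H →ₗᵢ[ℂ] Lp ℂ 2 μ) (hU : ∀ g, U g =ᵐ[μ] fun y => ⟪k y, g⟫_ℂ)
    {F : X → ℂ} (hF : MemLp F 2 μ) (x : X) (hrep : ∫ y, F y * conj ⟪k y, k x⟫_ℂ ∂μ = F x) :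
    ⟪k x, ContinuousLinearMap.adjoint U.toContinuousLinearMap hF.toLp⟫_ℂ = F x := by
  -- Moving the adjoint across leaves `⟪U (k x), F⟫`, and `U (k x)` is almost everywhere the kernel
  -- function at `x`.
  rw [ContinuousLinearMap.adjoint_inner_right, L2.inner_def, ← hrep]
  refine integral_congr_ae ?_
  filter_upwards [hF.coeFn_toLp, hU (k x)] with y h1 h2
  rw [h1, LinearIsometry.coe_toContinuousLinearMap, h2, RCLike.inner_apply]

/-! ### Holomorphic changes of variables -/

/-- The real Jacobian determinant of multiplication by a complex number. -/
theorem det_restrictScalars_toSpanSingleton (c : ℂ) :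
    ((ContinuousLinearMap.toSpanSingleton ℂ c).restrictScalars ℝ).det = ‖c‖ ^ 2 := by
  have h : (ContinuousLinearMap.toSpanSingleton ℂ c : ℂ →ₗ[ℂ] ℂ) = LinearMap.mulLeft ℂ c := by
    ext; simp
  rw [ContinuousLinearMap.det]
  change LinearMap.det
    ((ContinuousLinearMap.toSpanSingleton ℂ c : ℂ →ₗ[ℂ] ℂ).restrictScalars ℝ) = _
  rw [h, LinearMap.det_restrictScalars, LinearMap.det_mulLeft, Algebra.norm_complex_eq]
  exact Complex.normSq_eq_norm_sq c

section HolomorphicChangeOfVariables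

variable {E : Type*} [NormedAddCommGroup E] [NormedSpace ℝ E] {s : Set ℂ} {φ φ' : ℂ → ℂ}

theorem integrableOn_image_iff_of_hasDerivAt (hs : MeasurableSet s)
    (hφ : ∀ z ∈ s, HasDerivAt φ (φ' z) z) (hinj : Set.InjOn φ s) (f : ℂ → E) :
    IntegrableOn f (φ '' s) ↔ IntegrableOn (fun z => ‖φ' z‖ ^ 2 • f (φ z)) s := by
  simpa [det_restrictScalars_toSpanSingleton] using
    integrableOn_image_iff_integrableOn_abs_det_fderiv_smul volume hs
      (fun z hz => ((hφ z hz).hasFDerivAt.restrictScalars ℝ).hasFDerivWithinAt) hinj f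

theorem integral_image_eq_of_hasDerivAt (hs : MeasurableSet s)
    (hφ : ∀ z ∈ s, HasDerivAt φ (φ' z) z) (hinj : Set.InjOn φ s) (f : ℂ → E) :
    ∫ z in φ '' s, f z = ∫ z in s, ‖φ' z‖ ^ 2 • f (φ z) := by
  simpa [det_restrictScalars_toSpanSingleton] using
    integral_image_eq_integral_abs_det_fderiv_smul volume hs
      (fun z hz => ((hφ z hz).hasFDerivAt.restrictScalars ℝ).hasFDerivWithinAt) hinj f

end HolomorphicChangeOfVariables

/-! ### Radial weights on the unit disc -/

/-- The mean value property for a radial weight on the unit disc. -/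
theorem setIntegral_ball_mul_radial {G : ℂ → ℂ} {w : ℝ → ℝ} (hw : Measurable w)
    (hG : DifferentiableOn ℂ G (Metric.ball 0 1))
    (hint : IntegrableOn (fun ζ => G ζ * (w ‖ζ‖ : ℂ)) (Metric.ball 0 1)) :
    ∫ ζ in Metric.ball 0 1, G ζ * (w ‖ζ‖ : ℂ) = G 0 * ∫ ζ in Metric.ball (0 : ℂ) 1, (w ‖ζ‖ : ℂ) := by
  let D : Set ℂ := Metric.ball 0 1
  have hD : MeasurableSet D := Metric.isOpen_ball.measurableSet
  let Gi : ℂ → ℂ := D.indicator fun ζ => G ζ * (w ‖ζ‖ : ℂ)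
  have hGi : Integrable Gi := (integrable_indicator_iff hD).2 hint
  let e : ℝ → ℂ → ℂ := fun θ ζ => rotation (Circle.exp θ) ζ
  have he : ∀ θ ζ, e θ ζ = circleMap 0 1 θ * ζ := fun θ ζ => by simp [e, circleMap]
  have hne : ∀ θ ζ, ‖e θ ζ‖ = ‖ζ‖ := fun θ ζ => LinearIsometryEquiv.norm_map _ _
  have heD : ∀ θ ζ, e θ ζ ∈ D ↔ ζ ∈ D := fun θ ζ => by
    simp only [D, mem_ball_zero_iff, hne]
  have hmp : ∀ θ, MeasurePreserving (e θ) := fun θ =>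
    LinearIsometryEquiv.measurePreserving (rotation (Circle.exp θ))
  have hemb : ∀ θ, MeasurableEmbedding (e θ) := fun θ =>
    (rotation (Circle.exp θ)).toHomeomorph.measurableEmbedding
  have hGimeas : Measurable Gi := by
    have h1 : Measurable (D.indicator G) := by
      classical
      rw [← Set.piecewise_eq_indicator]
      exact hG.continuousOn.measurable_piecewise continuousOn_const hD
    have : Gi = fun ζ => D.indicator G ζ * (w ‖ζ‖ : ℂ) := by
      ext ζ
      simp only [Gi, Set.indicator_mul_left]
    rw [this]
    fun_prop
  have hcm : Measurable fun p : ℝ × ℂ => e p.1 p.2 := by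
    simp only [he]
    exact (((continuous_circleMap 0 1).comp continuous_fst).mul continuous_snd).measurable
  -- The integral over the disc is invariant under every rotation, so it may be averaged over the
  -- angle; joint integrability permits taking the angular average first.
  have hprod : Integrable (Function.uncurry fun θ ζ => Gi (e θ ζ))
      ((volume.restrict (Set.uIoc 0 (2 * Real.pi))).prod volume) := by
    have hm : Measurable (Function.uncurry fun θ ζ => Gi (e θ ζ)) := hGimeas.comp hcm
    rw [integrable_prod_iff hm.aestronglyMeasurable]
    refine ⟨.of_forall fun θ => (hmp θ).integrable_comp_of_integrable hGi, ?_⟩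
    have : ∀ θ, ∫ ζ, ‖Gi (e θ ζ)‖ = ∫ ζ, ‖Gi ζ‖ := fun θ =>
      (hmp θ).integral_comp (hemb θ) fun ζ => ‖Gi ζ‖
    simp only [Function.uncurry_apply_pair, this]
    have : IsFiniteMeasure ((volume : Measure ℝ).restrict (Set.uIoc 0 (2 * Real.pi))) :=
      ⟨by simp [Set.uIoc]⟩
    exact integrable_const _
  have hmean : ∀ ζ, ∫ θ in (0)..(2 * Real.pi), Gi (e θ ζ) =
      D.indicator (fun ζ => 2 * Real.pi * (G 0 * (w ‖ζ‖ : ℂ))) ζ := by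
    intro ζ
    by_cases hζ : ζ ∈ D
    · have h1 : ∀ θ, Gi (e θ ζ) = G (circleMap 0 1 θ * ζ) * (w ‖ζ‖ : ℂ) := fun θ => by
        simp only [Gi]
        rw [Set.indicator_of_mem ((heD θ ζ).2 hζ), hne, he]
      simp only [h1]
      rw [Set.indicator_of_mem hζ, intervalIntegral.integral_mul_const]
      -- Since `‖ζ‖ < 1`, the function `u ↦ G (u * ζ)` is holomorphic near the closed unit disc, so
      -- its mean over the unit circle is `G 0`. No boundary regularity of `G` is needed.
      have hd : DiffContOnCl ℂ (fun u => G (u * ζ)) (Metric.ball 0 |1|) := by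
        rw [abs_one]
        have hmaps : ∀ u ∈ Metric.closedBall (0 : ℂ) 1, u * ζ ∈ Metric.ball (0 : ℂ) 1 := by
          intro u hu
          rw [mem_closedBall_zero_iff] at hu
          have hζ' : ‖ζ‖ < 1 := mem_ball_zero_iff.1 hζ
          rw [mem_ball_zero_iff, norm_mul]
          exact (mul_le_of_le_one_left (norm_nonneg _) hu).trans_lt hζ'
        refine DifferentiableOn.diffContOnCl_ball (U := (fun u => u * ζ) ⁻¹' Metric.ball 0 1) ?_ hmaps
        exact hG.comp (by fun_prop) fun u hu => hu
      have := hd.circleAverage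
      rw [Real.circleAverage] at this
      simp only [zero_mul] at this
      rw [← this, Complex.real_smul]
      have hpi : (Real.pi : ℂ) ≠ 0 := by exact_mod_cast Real.pi_ne_zero
      push_cast
      generalize (∫ θ in (0)..(2 * Real.pi), G (circleMap 0 1 θ * ζ)) = I
      field_simp
    · have h1 : ∀ θ, Gi (e θ ζ) = 0 := fun θ =>
        Set.indicator_of_notMem (fun h => hζ ((heD θ ζ).1 h)) _
      simp [h1, hζ]
  have hswap := integral_integral_swap hprod
  have hleft : ∀ θ, ∫ ζ, Gi (e θ ζ) = ∫ ζ, Gi ζ := fun θ => (hmp θ).integral_comp (hemb θ) Gi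
  have h2pi : (0 : ℝ) ≤ 2 * Real.pi := by positivity
  simp only [Set.uIoc_of_le h2pi, ← intervalIntegral.integral_of_le h2pi, hmean, hleft] at hswap
  rw [intervalIntegral.integral_const, integral_indicator hD, integral_indicator hD,
    integral_const_mul, integral_const_mul, Complex.real_smul] at hswap
  have hpi : ((2 * Real.pi : ℝ) : ℂ) ≠ 0 := by
    exact_mod_cast (by positivity : (2 * Real.pi : ℝ) ≠ 0)
  refine mul_left_cancel₀ hpi ?_
  simpa using hswap

/-- The integral of `r ↦ r (1 - r²)^(α-1)` over the unit interval. -/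
theorem integral_mul_one_sub_sq_rpow {α : ℝ} (hα : 0 < α) :
    IntegrableOn (fun r : ℝ => r * (1 - r ^ 2) ^ (α - 1)) (Set.Ioc 0 1) ∧
      ∫ r in (0 : ℝ)..1, r * (1 - r ^ 2) ^ (α - 1) = 1 / (2 * α) := by
  have hcont : ContinuousOn (fun r : ℝ => -(1 - r ^ 2) ^ α / (2 * α)) (Set.Icc 0 1) := by
    refine Continuous.continuousOn ?_
    refine Continuous.div_const (Continuous.neg ?_) _
    exact Continuous.rpow_const (by fun_prop) fun r => Or.inr hα.le
  have hderiv : ∀ r ∈ Set.Ioo (0 : ℝ) 1, HasDerivAt (fun r : ℝ => -(1 - r ^ 2) ^ α / (2 * α))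
      (r * (1 - r ^ 2) ^ (α - 1)) r := by
    intro r hr
    have h1 : 0 < 1 - r ^ 2 := by nlinarith [hr.1, hr.2]
    have h2 : HasDerivAt (fun r : ℝ => 1 - r ^ 2) (-(2 * r)) r := by
      simpa using ((hasDerivAt_id r).pow 2).const_sub 1
    have h3 := ((h2.rpow_const (p := α) (Or.inl h1.ne')).neg).div_const (2 * α)
    convert! h3 using 1
    field_simp
  -- For `α < 1` the integrand is unbounded at `1`. Integrability comes from its being the
  -- nonnegative derivative of a function continuous up to the endpoint.
  have hint : IntegrableOn (fun r : ℝ => r * (1 - r ^ 2) ^ (α - 1)) (Set.Ioc 0 1) := by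
    refine intervalIntegral.integrableOn_deriv_of_nonneg hcont hderiv fun r hr => ?_
    have h1 : 0 < 1 - r ^ 2 := by nlinarith [hr.1, hr.2]
    have := hr.1
    positivity
  refine ⟨hint, ?_⟩
  rw [intervalIntegral.integral_eq_sub_of_hasDerivAt_of_le zero_le_one hcont hderiv
    ((intervalIntegrable_iff_integrableOn_Ioc_of_le zero_le_one).2 hint)]
  simp [Real.zero_rpow hα.ne']
  ring

theorem integral_ball_one_sub_norm_sq_rpow {α : ℝ} (hα : 0 < α) :
    IntegrableOn (fun ζ : ℂ => (1 - ‖ζ‖ ^ 2) ^ (α - 1)) (Metric.ball 0 1) ∧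
      ∫ ζ in Metric.ball (0 : ℂ) 1, (1 - ‖ζ‖ ^ 2) ^ (α - 1) = Real.pi / α := by
  have hD : MeasurableSet (Metric.ball (0 : ℂ) 1) := Metric.isOpen_ball.measurableSet
  obtain ⟨h1, h2⟩ := integral_mul_one_sub_sq_rpow hα
  rw [intervalIntegral.integral_of_le zero_le_one] at h2
  have hind : ∀ ζ : ℂ, (Metric.ball (0 : ℂ) 1).indicator (fun ζ => (1 - ‖ζ‖ ^ 2) ^ (α - 1)) ζ =
      (fun r : ℝ => (Set.Iio 1).indicator (fun r => (1 - r ^ 2) ^ (α - 1)) r) ‖ζ‖ := by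
    intro ζ
    by_cases h : ‖ζ‖ < 1 <;> simp [h]
  have hind2 : ∀ r : ℝ, r * (Set.Iio 1).indicator (fun r : ℝ => (1 - r ^ 2) ^ (α - 1)) r =
      (Set.Iio 1).indicator (fun r : ℝ => r * (1 - r ^ 2) ^ (α - 1)) r := by
    intro r
    by_cases h : r < 1 <;> simp [h]
  have hset : Set.Ioi (0 : ℝ) ∩ Set.Iio 1 = Set.Ioo 0 1 := Set.Ioi_inter_Iio
  constructor
  · rw [← integrable_indicator_iff hD]
    refine Integrable.congr (f := fun ζ : ℂ => (fun r : ℝ =>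
      (Set.Iio 1).indicator (fun r => (1 - r ^ 2) ^ (α - 1)) r) ‖ζ‖) ?_
      (.of_forall fun ζ => (hind ζ).symm)
    rw [integrable_fun_norm_addHaar (volume : Measure ℂ)]
    simp only [Complex.finrank_real_complex, smul_eq_mul, Nat.add_one_sub_one, pow_one, hind2]
    rw [IntegrableOn, integrable_indicator_iff measurableSet_Iio, IntegrableOn,
      Measure.restrict_restrict measurableSet_Iio, Set.inter_comm, hset]
    exact h1.mono_set Set.Ioo_subset_Ioc_self
  · rw [← integral_indicator hD]
    simp only [hind]
    rw [integral_fun_norm_addHaar (volume : Measure ℂ)]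
    simp only [Complex.finrank_real_complex, smul_eq_mul, Nat.add_one_sub_one, pow_one, hind2]
    rw [setIntegral_indicator measurableSet_Iio, hset, ← integral_Ioc_eq_integral_Ioo, h2,
      Measure.real, Complex.volume_ball]
    simp
    field_simp

/-! ### The Cayley transform -/

/-- The Cayley transform from the unit disc onto the right half-plane that sends `0` to `w₀`. -/
noncomputable def cayley (w₀ ζ : ℂ) : ℂ := (w₀ + conj w₀ * ζ) / (1 - ζ)

section Cayley

variable {w₀ ζ : ℂ}

theorem one_sub_ne_zero_of_mem_ball (hζ : ζ ∈ Metric.ball (0 : ℂ) 1) : 1 - ζ ≠ 0 := by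
  intro h
  rw [mem_ball_zero_iff, ← sub_eq_zero.1 h, norm_one] at hζ
  exact lt_irrefl _ hζ

theorem one_sub_norm_sq_pos (hζ : ζ ∈ Metric.ball (0 : ℂ) 1) : 0 < 1 - ‖ζ‖ ^ 2 := by
  rw [mem_ball_zero_iff] at hζ
  nlinarith [norm_nonneg ζ]

theorem cayley_zero : cayley w₀ 0 = w₀ := by simp [cayley]

/-- The base of the half-plane kernel becomes a positive constant over `1 - ζ`. This makes the
kernel a power of `1 - ζ`, and also gives injectivity of the transform. -/
theorem cayley_add_conj (hζ : 1 - ζ ≠ 0) :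
    cayley w₀ ζ + conj w₀ = ((2 * w₀.re : ℝ) : ℂ) * (1 - ζ)⁻¹ := by
  have : ((2 * w₀.re : ℝ) : ℂ) = w₀ + conj w₀ := (Complex.add_conj w₀).symm
  rw [cayley, this]
  field_simp
  ring

theorem re_cayley (w₀ ζ : ℂ) :
    (cayley w₀ ζ).re = w₀.re * (1 - ‖ζ‖ ^ 2) / ‖1 - ζ‖ ^ 2 := by
  rw [cayley, Complex.div_re, ← add_div, ← Complex.normSq_eq_norm_sq, ← Complex.normSq_eq_norm_sq]
  congr 1
  simp [Complex.normSq_apply]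
  ring

theorem hasDerivAt_cayley (hζ : 1 - ζ ≠ 0) :
    HasDerivAt (cayley w₀) (((2 * w₀.re : ℝ) : ℂ) / (1 - ζ) ^ 2) ζ := by
  have h1 : HasDerivAt (fun ζ => w₀ + conj w₀ * ζ) (conj w₀) ζ := by
    simpa using ((hasDerivAt_id ζ).const_mul (conj w₀)).const_add w₀
  have h2 : HasDerivAt (fun ζ : ℂ => 1 - ζ) (-1) ζ := by
    simpa using (hasDerivAt_id ζ).const_sub 1
  have : ((2 * w₀.re : ℝ) : ℂ) = w₀ + conj w₀ := (Complex.add_conj w₀).symm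
  convert! h1.div h2 hζ using 1
  rw [this]
  ring

theorem bijOn_cayley (hw₀ : 0 < w₀.re) :
    Set.BijOn (cayley w₀) (Metric.ball 0 1) {w | 0 < w.re} := by
  have hne : ∀ w : ℂ, 0 < w.re → w + conj w₀ ≠ 0 := fun w hw h => by
    have := congrArg Complex.re h
    simp at this
    linarith
  have hx : ((2 * w₀.re : ℝ) : ℂ) ≠ 0 := by exact_mod_cast (by positivity : 2 * w₀.re ≠ 0)
  refine ⟨fun ζ hζ => ?_, fun ζ hζ ξ hξ h => ?_, fun w hw => ?_⟩
  · have h0 := one_sub_ne_zero_of_mem_ball hζ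
    have h1 := one_sub_norm_sq_pos hζ
    have h2 : 0 < ‖1 - ζ‖ := norm_pos_iff.2 h0
    change 0 < (cayley w₀ ζ).re
    rw [re_cayley]
    positivity
  · have h1 := cayley_add_conj (w₀ := w₀) (one_sub_ne_zero_of_mem_ball hζ)
    rw [h, cayley_add_conj (one_sub_ne_zero_of_mem_ball hξ)] at h1
    exact (sub_right_injective (inv_injective (mul_left_cancel₀ hx h1))).symm
  · have hw' : 0 < w.re := hw
    have hn := hne w hw
    refine ⟨(w - w₀) / (w + conj w₀), ?_, ?_⟩
    · rw [mem_ball_zero_iff, norm_div, div_lt_one (norm_pos_iff.2 hn)]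
      refine lt_of_pow_lt_pow_left₀ 2 (norm_nonneg _) ?_
      rw [← Complex.normSq_eq_norm_sq, ← Complex.normSq_eq_norm_sq]
      simp [Complex.normSq_apply]
      nlinarith [mul_pos hw' hw₀]
    · have h3 : 1 - (w - w₀) / (w + conj w₀) = ((2 * w₀.re : ℝ) : ℂ) / (w + conj w₀) := by
        have : ((2 * w₀.re : ℝ) : ℂ) = w₀ + conj w₀ := (Complex.add_conj w₀).symm
        rw [this]
        field_simp
        ring
      have h4 : 1 - (w - w₀) / (w + conj w₀) ≠ 0 := by
        rw [h3]
        exact div_ne_zero hx hn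
      have h5 := cayley_add_conj (w₀ := w₀) h4
      rw [h3, inv_div, mul_div_cancel₀ _ hx] at h5
      exact add_right_cancel h5

end Cayley

/-- No branch correction appears: a positive factor shifts the logarithm by a real number, and
inversion negates it as `u` is off the negative axis. -/
theorem ofReal_mul_inv_cpow {r : ℝ} (hr : 0 < r) {u : ℂ} (hu : 0 < u.re) (p : ℂ) :
    ((r : ℂ) * u⁻¹) ^ p = (r : ℂ) ^ p * (u ^ p)⁻¹ := by
  have hu0 : u ≠ 0 := fun h => by simp [h] at hu
  have hr0 : (r : ℂ) ≠ 0 := by exact_mod_cast hr.ne'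
  have harg : u.arg ≠ Real.pi := fun h => by
    rw [Complex.arg_eq_pi_iff] at h
    exact lt_asymm hu h.1
  rw [← Complex.inv_cpow _ _ harg, Complex.cpow_def_of_ne_zero (mul_ne_zero hr0 (inv_ne_zero hu0)),
    Complex.cpow_def_of_ne_zero hr0, Complex.cpow_def_of_ne_zero (inv_ne_zero hu0),
    Complex.log_ofReal_mul hr (inv_ne_zero hu0), ← Complex.exp_add, ← Complex.ofReal_log hr.le,
    add_mul]

/-! ### Weighted Bergman spaces of the right half-plane -/

section HalfPlane

variable {α : ℝ} {w₀ : ℂ} {f : ℂ → ℂ}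

/-- The transport of a function on the right half-plane to the unit disc. -/
noncomputable def discTransport (α : ℝ) (w₀ : ℂ) (f : ℂ → ℂ) (ζ : ℂ) : ℂ :=
  f (cayley w₀ ζ) * ((1 - ζ) ^ ((α + 1 : ℝ) : ℂ))⁻¹

theorem one_sub_re_pos {ζ : ℂ} (hζ : ζ ∈ Metric.ball (0 : ℂ) 1) : 0 < (1 - ζ).re := by
  rw [mem_ball_zero_iff] at hζ
  have := (Complex.re_le_norm ζ).trans_lt hζ
  simpa using this

theorem norm_one_sub_cpow {ζ : ℂ} (p : ℝ) :
    ‖(1 - ζ) ^ (p : ℂ)‖ = ‖1 - ζ‖ ^ p := Complex.norm_cpow_real _ _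

theorem differentiableOn_discTransport (hw₀ : 0 < w₀.re)
    (hf : DifferentiableOn ℂ f {w | 0 < w.re}) :
    DifferentiableOn ℂ (discTransport α w₀ f) (Metric.ball 0 1) := by
  have h1 : DifferentiableOn ℂ (cayley w₀) (Metric.ball 0 1) := fun ζ hζ =>
    (hasDerivAt_cayley (one_sub_ne_zero_of_mem_ball hζ)).differentiableAt.differentiableWithinAt
  refine (hf.comp h1 (bijOn_cayley hw₀).mapsTo).mul (DifferentiableOn.inv ?_ fun ζ hζ => ?_)
  · refine DifferentiableOn.cpow (by fun_prop) (by fun_prop) fun ζ hζ => Or.inl ?_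
    exact one_sub_re_pos hζ
  · rw [Complex.cpow_ne_zero_iff]
    exact Or.inl (one_sub_ne_zero_of_mem_ball hζ)

/-- With `x = Re w₀`, `b = 1 - ‖ζ‖²` and `d = ‖1 - ζ‖`, the left side is the Jacobian times the
transported weight. The factor `(d ^ (α + 1))⁻²` is exactly what `discTransport` absorbs, leaving a
radial weight. -/
theorem jacobian_weight_identity {x b d : ℝ} (hx : 0 < x) (hb : 0 < b) (hd : 0 < d) (α : ℝ) :
    (2 * x / d ^ 2) ^ 2 * (x * b / d ^ 2) ^ (α - 1) =
      4 * x ^ (α + 1) * ((d ^ (α + 1)) ^ 2)⁻¹ * b ^ (α - 1) := by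
  rw [Real.div_rpow (by positivity) (by positivity), Real.mul_rpow hx.le hb.le,
    ← Real.rpow_natCast d 2, ← Real.rpow_natCast (d ^ (α + 1)) 2, ← Real.rpow_mul hd.le,
    ← Real.rpow_mul hd.le, div_pow, mul_pow, ← Real.rpow_natCast (d ^ _) 2, ← Real.rpow_mul hd.le,
    ← Real.rpow_natCast x 2, show α + 1 = (α - 1) + 2 by ring, Real.rpow_add hx,
    show ((α - 1) + 2) * ((2 : ℕ) : ℝ) = ((2 : ℕ) : ℝ) * (α - 1) + ((2 : ℕ) : ℝ) * ((2 : ℕ) : ℝ) by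
      push_cast; ring, Real.rpow_add hd]
  norm_num
  field_simp

theorem norm_deriv_cayley_sq (hw₀ : 0 < w₀.re) (ζ : ℂ) :
    ‖((2 * w₀.re : ℝ) : ℂ) / (1 - ζ) ^ 2‖ ^ 2 = (2 * w₀.re / ‖1 - ζ‖ ^ 2) ^ 2 := by
  rw [norm_div, norm_pow, Complex.norm_real, Real.norm_of_nonneg (by positivity)]

theorem integrableOn_halfPlane_iff (hw₀ : 0 < w₀.re) (f : ℂ → ℂ) :
    IntegrableOn (fun w => ‖f w‖ ^ 2 * w.re ^ (α - 1)) {w | 0 < w.re} ↔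
      IntegrableOn (fun ζ => ‖discTransport α w₀ f ζ‖ ^ 2 * (1 - ‖ζ‖ ^ 2) ^ (α - 1))
        (Metric.ball 0 1) := by
  have hD : MeasurableSet (Metric.ball (0 : ℂ) 1) := Metric.isOpen_ball.measurableSet
  have hb := bijOn_cayley hw₀
  rw [← hb.image_eq, integrableOn_image_iff_of_hasDerivAt hD
    (fun ζ hζ => hasDerivAt_cayley (one_sub_ne_zero_of_mem_ball hζ)) hb.injOn]
  have h4 : (4 * w₀.re ^ (α + 1)) ≠ 0 := by positivity
  refine Iff.trans (integrableOn_congr_fun (fun ζ hζ => ?_) hD)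
    (integrable_const_mul_iff (isUnit_iff_ne_zero.2 h4)
      (fun ζ => ‖discTransport α w₀ f ζ‖ ^ 2 * (1 - ‖ζ‖ ^ 2) ^ (α - 1)))
  have h0 := one_sub_ne_zero_of_mem_ball hζ
  simp only [smul_eq_mul]
  rw [norm_deriv_cayley_sq hw₀, re_cayley, discTransport, norm_mul, norm_inv,
    norm_one_sub_cpow, mul_left_comm, jacobian_weight_identity hw₀ (one_sub_norm_sq_pos hζ)
    (norm_pos_iff.2 h0)]
  ring

/-- The reproducing formula of the weighted Bergman spaces of the right half-plane. -/
theorem halfPlane_reproducing (hα : 0 < α) (hf : DifferentiableOn ℂ f {w | 0 < w.re})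
    (hint : IntegrableOn (fun w => ‖f w‖ ^ 2 * w.re ^ (α - 1)) {w | 0 < w.re}) (hw₀ : 0 < w₀.re) :
    ∫ w in {w : ℂ | 0 < w.re}, f w * conj ((w + conj w₀) ^ ((-(α + 1) : ℝ) : ℂ)) *
      ((w.re ^ (α - 1) : ℝ) : ℂ) = ((Real.pi * 2 ^ (1 - α) / α : ℝ) : ℂ) * f w₀ := by
  have hD : MeasurableSet (Metric.ball (0 : ℂ) 1) := Metric.isOpen_ball.measurableSet
  have hb := bijOn_cayley hw₀
  rw [integrableOn_halfPlane_iff hw₀] at hint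
  have hG := differentiableOn_discTransport (α := α) hw₀ hf
  set G := discTransport α w₀ f
  obtain ⟨hI1, hI2⟩ := integral_ball_one_sub_norm_sq_rpow hα
  -- The weight has finite mass, so `‖G‖ ≤ ‖G‖² + 1` reduces integrability to square integrability.
  have hGint : IntegrableOn (fun ζ => G ζ * (((1 - ‖ζ‖ ^ 2) ^ (α - 1) : ℝ) : ℂ))
      (Metric.ball 0 1) := by
    refine Integrable.mono' (hint.add hI1) ?_ ?_
    · refine (hG.continuousOn.aestronglyMeasurable hD).mul ?_
      exact (by fun_prop : Measurable fun ζ : ℂ =>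
        (((1 - ‖ζ‖ ^ 2) ^ (α - 1) : ℝ) : ℂ)).aestronglyMeasurable
    · refine (ae_restrict_iff' hD).2 (.of_forall fun ζ hζ => ?_)
      have h1 : 0 ≤ (1 - ‖ζ‖ ^ 2) ^ (α - 1) := Real.rpow_nonneg (one_sub_norm_sq_pos hζ).le _
      rw [norm_mul, Complex.norm_real, Real.norm_of_nonneg h1, Pi.add_apply]
      nlinarith [sq_nonneg (‖G ζ‖ - 1), norm_nonneg (G ζ),
        mul_nonneg (add_nonneg (sq_nonneg (‖G ζ‖ - 1)) (norm_nonneg (G ζ))) h1]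
  have hmean := setIntegral_ball_mul_radial (w := fun r => (1 - r ^ 2) ^ (α - 1)) (by fun_prop) hG
    hGint
  have hG0 : G 0 = f w₀ := by simp [G, discTransport, cayley_zero]
  have hmass : ∫ ζ in Metric.ball (0 : ℂ) 1, (((1 - ‖ζ‖ ^ 2) ^ (α - 1) : ℝ) : ℂ) =
      ((Real.pi / α : ℝ) : ℂ) := by
    rw [← hI2]
    exact integral_ofReal
  rw [hmass, hG0] at hmean
  rw [← hb.image_eq, integral_image_eq_of_hasDerivAt hD
    (fun ζ hζ => hasDerivAt_cayley (one_sub_ne_zero_of_mem_ball hζ)) hb.injOn]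
  -- Up to a constant the kernel is `v = (1 - ζ) ^ (α + 1)`. Writing `conj v = ‖v‖² v⁻¹`, the factor
  -- `‖v‖²` cancels against the Jacobian and weight, while `v⁻¹` completes `f ∘ cayley` to `G`. What
  -- remains is holomorphic times radial, with constant `4 * 2 ^ (-(α + 1)) = 2 ^ (1 - α)`.
  have hcongr : ∀ ζ ∈ Metric.ball (0 : ℂ) 1,
      ‖((2 * w₀.re : ℝ) : ℂ) / (1 - ζ) ^ 2‖ ^ 2 • (f (cayley w₀ ζ) *
        conj ((cayley w₀ ζ + conj w₀) ^ ((-(α + 1) : ℝ) : ℂ)) *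
          (((cayley w₀ ζ).re ^ (α - 1) : ℝ) : ℂ)) =
      ((2 ^ (1 - α) : ℝ) : ℂ) * (G ζ * (((1 - ‖ζ‖ ^ 2) ^ (α - 1) : ℝ) : ℂ)) := by
    intro ζ hζ
    have h0 := one_sub_ne_zero_of_mem_ball hζ
    have hd : 0 < ‖1 - ζ‖ := norm_pos_iff.2 h0
    have hx : 0 < 2 * w₀.re := by positivity
    set v : ℂ := (1 - ζ) ^ ((α + 1 : ℝ) : ℂ) with hv
    have hv0 : v ≠ 0 := by
      rw [hv, Complex.cpow_ne_zero_iff]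
      exact Or.inl h0
    have hvn : ‖v‖ = ‖1 - ζ‖ ^ (α + 1) := norm_one_sub_cpow _
    have hk : (cayley w₀ ζ + conj w₀) ^ ((-(α + 1) : ℝ) : ℂ) =
        (((2 * w₀.re) ^ (-(α + 1)) : ℝ) : ℂ) * v := by
      rw [cayley_add_conj h0, ofReal_mul_inv_cpow hx (one_sub_re_pos hζ),
        Complex.ofReal_cpow hx.le, hv]
      congr 1
      rw [Complex.ofReal_neg, Complex.cpow_neg, inv_inv]
    have hconj : conj v = ((‖v‖ ^ 2 : ℝ) : ℂ) * v⁻¹ := by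
      rw [eq_mul_inv_iff_mul_eq₀ hv0, mul_comm, Complex.mul_conj, Complex.normSq_eq_norm_sq]
    have hj := jacobian_weight_identity hw₀ (one_sub_norm_sq_pos hζ) hd α
    rw [← hvn] at hj
    have hv2 : ‖v‖ ^ 2 ≠ 0 := pow_ne_zero _ (norm_ne_zero_iff.2 hv0)
    have hreal : (2 * w₀.re / ‖1 - ζ‖ ^ 2) ^ 2 * ((2 * w₀.re) ^ (-(α + 1)) * ‖v‖ ^ 2) *
        (w₀.re * (1 - ‖ζ‖ ^ 2) / ‖1 - ζ‖ ^ 2) ^ (α - 1) =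
        2 ^ (1 - α) * (1 - ‖ζ‖ ^ 2) ^ (α - 1) := by
      rw [mul_right_comm, hj, Real.mul_rpow two_pos.le hw₀.le, Real.rpow_neg hw₀.le,
        show 1 - α = -(α + 1) + 2 by ring, Real.rpow_add two_pos]
      have : w₀.re ^ (α + 1) ≠ 0 := by positivity
      norm_num
      field_simp
    rw [norm_deriv_cayley_sq hw₀, hk, map_mul, Complex.conj_ofReal, hconj, re_cayley,
      Complex.real_smul]
    have hreal' := congrArg (fun r : ℝ => (r : ℂ)) hreal
    simp only [Complex.ofReal_mul] at hreal'
    calc _ = f (cayley w₀ ζ) * v⁻¹ * (((2 * w₀.re / ‖1 - ζ‖ ^ 2) ^ 2 : ℝ) *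
        (((2 * w₀.re) ^ (-(α + 1)) : ℝ) * (‖v‖ ^ 2 : ℝ)) *
        ((w₀.re * (1 - ‖ζ‖ ^ 2) / ‖1 - ζ‖ ^ 2) ^ (α - 1) : ℝ)) := by ring
      _ = _ := by
        rw [hreal']
        simp only [G, discTransport, ← hv]
        ring
  rw [setIntegral_congr_fun hD hcongr, integral_const_mul, hmean]
  push_cast
  ring

/-- Transported to the disc centred at its own base point, the kernel has constant modulus, so its
norm is the finite mass of the radial weight. -/
theorem integrableOn_halfPlane_kernel (hα : 0 < α) (hw₀ : 0 < w₀.re) :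
    IntegrableOn (fun w => ‖(w + conj w₀) ^ ((-(α + 1) : ℝ) : ℂ)‖ ^ 2 * w.re ^ (α - 1))
      {w | 0 < w.re} := by
  have hD : MeasurableSet (Metric.ball (0 : ℂ) 1) := Metric.isOpen_ball.measurableSet
  rw [integrableOn_halfPlane_iff hw₀ (fun w => (w + conj w₀) ^ ((-(α + 1) : ℝ) : ℂ))]
  have h1 : IntegrableOn (fun ζ : ℂ => ((2 * w₀.re) ^ (-(α + 1))) ^ 2 * (1 - ‖ζ‖ ^ 2) ^ (α - 1))
      (Metric.ball 0 1) := (integral_ball_one_sub_norm_sq_rpow hα).1.const_mul _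
  refine h1.congr_fun (fun ζ hζ => ?_) hD
  have h0 := one_sub_ne_zero_of_mem_ball hζ
  have hx : 0 < 2 * w₀.re := by positivity
  have hd : 0 < ‖1 - ζ‖ := norm_pos_iff.2 h0
  simp only [discTransport]
  congr 2
  rw [norm_mul, norm_inv, norm_one_sub_cpow, Complex.norm_cpow_real, cayley_add_conj h0, norm_mul,
    norm_inv, Complex.norm_real, Real.norm_of_nonneg hx.le, Real.mul_rpow hx.le (by positivity),
    Real.inv_rpow hd.le, Real.rpow_neg hd.le, inv_inv, mul_assoc, mul_inv_cancel₀ (by positivity),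
    mul_one]

end HalfPlane

/-! ### The sector and complex powers on it -/

section Sector

variable {α : ℝ}

theorem abs_arg_lt_of_mem_sector (hα2 : α ≤ 2) {z : ℂ} (hz : z ∈ sector α) :
    |z.arg| < Real.pi / 2 :=
  hz.2.trans_le (by nlinarith [Real.pi_pos])

theorem re_pos_of_mem_sector (hα2 : α ≤ 2) {z : ℂ} (hz : z ∈ sector α) : 0 < z.re :=
  (Complex.abs_arg_lt_pi_div_two_iff.1 (abs_arg_lt_of_mem_sector hα2 hz)).resolve_right hz.1

theorem mem_slitPlane_of_mem_sector (hα2 : α ≤ 2) {z : ℂ} (hz : z ∈ sector α) :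
    z ∈ Complex.slitPlane := Or.inl (re_pos_of_mem_sector hα2 hz)

theorem arg_ne_pi_of_mem_sector (hα2 : α ≤ 2) {z : ℂ} (hz : z ∈ sector α) :
    z.arg ≠ Real.pi := (Complex.mem_slitPlane_iff_arg.1 (mem_slitPlane_of_mem_sector hα2 hz)).1

theorem isOpen_sector (hα2 : α ≤ 2) : IsOpen (sector α) := by
  have h : sector α = Complex.slitPlane ∩ Complex.arg ⁻¹' Set.Ioo (-(Real.pi * α / 4))
      (Real.pi * α / 4) := by
    ext z
    constructor
    · exact fun hz => ⟨mem_slitPlane_of_mem_sector hα2 hz, abs_lt.1 hz.2⟩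
    · exact fun hz => ⟨Complex.slitPlane_ne_zero hz.1, abs_lt.2 hz.2⟩
  rw [h]
  exact ContinuousOn.isOpen_inter_preimage
    (fun z hz => (Complex.continuousAt_arg hz).continuousWithinAt) Complex.isOpen_slitPlane
    isOpen_Ioo

/-- The bound on `p * arg z` keeps `p * log z` in the strip where the principal logarithm inverts
the exponential. -/
theorem log_cpow_ofReal {z : ℂ} (hz : z ≠ 0) {p : ℝ} (hp : |p * z.arg| < Real.pi) :
    Complex.log (z ^ (p : ℂ)) = p * Complex.log z := by
  have him : (Complex.log z * p).im = p * z.arg := by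
    simp [Complex.log_im, mul_comm]
  rw [Complex.cpow_def_of_ne_zero hz, Complex.log_exp, mul_comm]
  · rw [him]; exact (abs_lt.1 hp).1
  · rw [him]; exact (abs_lt.1 hp).2.le

theorem arg_cpow_ofReal {z : ℂ} (hz : z ≠ 0) {p : ℝ} (hp : |p * z.arg| < Real.pi) :
    (z ^ (p : ℂ)).arg = p * z.arg := by
  rw [← Complex.log_im, log_cpow_ofReal hz hp, Complex.im_ofReal_mul, Complex.log_im]

theorem cpow_ofReal_cpow_ofReal_inv {z : ℂ} (hz : z ≠ 0) {p q : ℝ} (hp : |p * z.arg| < Real.pi)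
    (hpq : p * q = 1) : (z ^ (p : ℂ)) ^ (q : ℂ) = z := by
  have hne : z ^ (p : ℂ) ≠ 0 := by
    rw [Complex.cpow_ne_zero_iff]
    exact Or.inl hz
  have h : (p : ℂ) * q = 1 := by exact_mod_cast hpq
  rw [Complex.cpow_def_of_ne_zero hne, log_cpow_ofReal hz hp,
    show (p : ℂ) * Complex.log z * q = (p * q) * Complex.log z by ring, h, one_mul,
    Complex.exp_log hz]

end Sector

/-! ### The power map from the half-plane to the sector -/

section PowerMap

variable {α : ℝ}

theorem abs_two_div_mul_arg_lt (hα : 0 < α) {z : ℂ} (hz : z ∈ sector α) :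
    |2 / α * z.arg| < Real.pi / 2 := by
  rw [abs_mul, abs_of_pos (by positivity)]
  calc 2 / α * |z.arg| < 2 / α * (Real.pi * α / 4) := by
        have := hz.2
        gcongr
    _ = Real.pi / 2 := by field_simp; ring

theorem abs_half_mul_arg_lt (hα : 0 < α) {w : ℂ} (hw : 0 < w.re) :
    |α / 2 * w.arg| < Real.pi * α / 4 := by
  rw [abs_mul, abs_of_pos (by positivity)]
  calc α / 2 * |w.arg| < α / 2 * (Real.pi / 2) := by
        have := Complex.abs_arg_lt_pi_div_two_iff.2 (Or.inl hw)
        gcongr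
    _ = Real.pi * α / 4 := by ring

theorem cpow_half_cpow_two_div (hα : 0 < α) (hα2 : α ≤ 2) {w : ℂ} (hw : 0 < w.re) :
    (w ^ ((α / 2 : ℝ) : ℂ)) ^ ((2 / α : ℝ) : ℂ) = w := by
  refine cpow_ofReal_cpow_ofReal_inv (fun h => by simp [h] at hw)
    ((abs_half_mul_arg_lt hα hw).trans_le ?_) (by field_simp)
  nlinarith [Real.pi_pos]

theorem cpow_two_div_cpow_half (hα : 0 < α) {z : ℂ} (hz : z ∈ sector α) :
    (z ^ ((2 / α : ℝ) : ℂ)) ^ ((α / 2 : ℝ) : ℂ) = z :=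
  cpow_ofReal_cpow_ofReal_inv hz.1
    ((abs_two_div_mul_arg_lt hα hz).trans (half_lt_self Real.pi_pos)) (by field_simp)

/-- The real part of `z ^ (2 / α)` is positive on the sector. -/
theorem rePow_pos (hα : 0 < α) {z : ℂ} (hz : z ∈ sector α) : 0 < rePow α z := by
  have hne : z ^ ((2 / α : ℝ) : ℂ) ≠ 0 := by
    rw [Complex.cpow_ne_zero_iff]
    exact Or.inl hz.1
  refine (Complex.abs_arg_lt_pi_div_two_iff.1 ?_).resolve_right hne
  have h := abs_two_div_mul_arg_lt hα hz
  rwa [arg_cpow_ofReal hz.1 (h.trans (half_lt_self Real.pi_pos))]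

theorem bijOn_cpow_half (hα : 0 < α) (hα2 : α ≤ 2) :
    Set.BijOn (fun w : ℂ => w ^ ((α / 2 : ℝ) : ℂ)) {w | 0 < w.re} (sector α) := by
  refine ⟨fun w hw => ?_, fun w hw w' hw' h => ?_, fun z hz => ?_⟩
  · have hw' : 0 < w.re := hw
    have hw0 : w ≠ 0 := fun h => by simp [h] at hw'
    have h := abs_half_mul_arg_lt hα hw
    refine ⟨?_, ?_⟩
    · simp only [ne_eq, Complex.cpow_eq_zero_iff, hw0, false_and, not_false_iff]
    · rwa [arg_cpow_ofReal hw0 (h.trans_le (by nlinarith [Real.pi_pos]))]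
  · have h' := congrArg (fun z : ℂ => z ^ ((2 / α : ℝ) : ℂ)) h
    simp only [cpow_half_cpow_two_div hα hα2 hw, cpow_half_cpow_two_div hα hα2 hw'] at h'
    exact h'
  · exact ⟨z ^ ((2 / α : ℝ) : ℂ), rePow_pos hα hz, cpow_two_div_cpow_half hα hz⟩

theorem rePow_cpow_half (hα : 0 < α) (hα2 : α ≤ 2) {w : ℂ} (hw : 0 < w.re) :
    rePow α (w ^ ((α / 2 : ℝ) : ℂ)) = w.re := by
  rw [rePow, cpow_half_cpow_two_div hα hα2 hw]

theorem hasDerivAt_cpow_half (α : ℝ) {w : ℂ} (hw : 0 < w.re) :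
    HasDerivAt (fun w : ℂ => w ^ ((α / 2 : ℝ) : ℂ))
      (((α / 2 : ℝ) : ℂ) * w ^ (((α / 2 - 1 : ℝ)) : ℂ)) w := by
  simpa using (hasDerivAt_id w).cpow_const (c := ((α / 2 : ℝ) : ℂ)) (Or.inl hw)

end PowerMap

/-! ### Transfer of the measure to the half-plane -/

section Transfer

variable {α t : ℝ}

/-- The density of `sectorMeasure` with respect to the area measure. -/
noncomputable def sectorDensity (α t : ℝ) (z : ℂ) : ℝ :=
  Real.pi⁻¹ * 2 ^ (α - 1) * ProbabilityTheory.beta (α / 2) (α / 2) *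
    ‖z‖ ^ (4 * (1 - α) / α) * Real.exp (α ^ 2 / (2 * t) * rePow α z) * rePow α z ^ (α - 1)

theorem measurable_sectorDensity (α t : ℝ) : Measurable (sectorDensity α t) := by
  have := measurable_rePow α
  unfold sectorDensity
  fun_prop

theorem beta_half_pos (hα : 0 < α) : 0 < ProbabilityTheory.beta (α / 2) (α / 2) :=
  ProbabilityTheory.beta_pos (by positivity) (by positivity)

theorem sectorDensity_pos (hα : 0 < α) {z : ℂ} (hz : z ∈ sector α) : 0 < sectorDensity α t z := by
  have h1 := rePow_pos hα hz
  have h2 := norm_pos_iff.2 hz.1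
  have h3 := beta_half_pos hα
  unfold sectorDensity
  positivity

/-- The constant of the transfer from the sector to the right half-plane. -/
noncomputable def transferConst (α : ℝ) : ℝ :=
  (α / 2) ^ 2 * (Real.pi⁻¹ * 2 ^ (α - 1) * ProbabilityTheory.beta (α / 2) (α / 2))

theorem transferConst_pos (hα : 0 < α) : 0 < transferConst α := by
  have h3 := beta_half_pos hα
  unfold transferConst
  positivity

/-- The density on the right half-plane that corresponds to `sectorMeasure`. -/
noncomputable def halfPlaneDensity (α t : ℝ) (w : ℂ) : ℝ :=
  transferConst α * (‖w‖ ^ (-α) * Real.exp (α ^ 2 / (2 * t) * w.re) * w.re ^ (α - 1))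

/-- The powers of `‖w‖` combine as `2 (α/2 - 1) + (α/2) * 4 (1 - α) / α = -α`. -/
theorem norm_deriv_sq_mul_sectorDensity (hα : 0 < α) (hα2 : α ≤ 2) {w : ℂ} (hw : 0 < w.re) :
    ‖((α / 2 : ℝ) : ℂ) * w ^ (((α / 2 - 1 : ℝ)) : ℂ)‖ ^ 2 *
      sectorDensity α t (w ^ ((α / 2 : ℝ) : ℂ)) = halfPlaneDensity α t w := by
  have hw0 : 0 < ‖w‖ := norm_pos_iff.2 fun h => by simp [h] at hw
  have hpow : (‖w‖ ^ (α / 2 - 1)) ^ 2 * (‖w‖ ^ (α / 2)) ^ (4 * (1 - α) / α) = ‖w‖ ^ (-α) := by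
    rw [← Real.rpow_natCast, ← Real.rpow_mul hw0.le, ← Real.rpow_mul hw0.le, ← Real.rpow_add hw0]
    congr 1
    field_simp
    push_cast
    ring
  rw [halfPlaneDensity, ← hpow, sectorDensity, rePow_cpow_half hα hα2 hw, norm_mul,
    Complex.norm_cpow_real, Complex.norm_cpow_real, Complex.norm_real,
    Real.norm_of_nonneg (by positivity), transferConst]
  ring

theorem sectorMeasure_eq (α t : ℝ) : sectorMeasure α t =
    (areaMeasure α).withDensity fun z => ENNReal.ofReal (sectorDensity α t z) := rfl

variable {E : Type*} [NormedAddCommGroup E] [NormedSpace ℝ E]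

theorem integrable_sectorMeasure_iff_density (hα : 0 < α) (Φ : sector α → E) :
    Integrable Φ (sectorMeasure α t) ↔
      Integrable (fun z : sector α => sectorDensity α t z • Φ z) (areaMeasure α) := by
  have hm : Measurable fun z : sector α => ENNReal.ofReal (sectorDensity α t z) :=
    ((measurable_sectorDensity α t).comp measurable_subtype_coe).ennreal_ofReal
  rw [sectorMeasure_eq, integrable_withDensity_iff_integrable_smul' hm
    (.of_forall fun z => ENNReal.ofReal_lt_top)]
  simp only [fun z : sector α => ENNReal.toReal_ofReal (sectorDensity_pos (t := t) hα z.2).le]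

theorem integral_sectorMeasure_density (hα : 0 < α) (Φ : sector α → E) :
    ∫ z, Φ z ∂sectorMeasure α t = ∫ z : sector α, sectorDensity α t z • Φ z ∂areaMeasure α := by
  have hm : Measurable fun z : sector α => ENNReal.ofReal (sectorDensity α t z) :=
    ((measurable_sectorDensity α t).comp measurable_subtype_coe).ennreal_ofReal
  rw [sectorMeasure_eq, integral_withDensity_eq_integral_toReal_smul hm
    (.of_forall fun z => ENNReal.ofReal_lt_top)]
  simp only [fun z : sector α => ENNReal.toReal_ofReal (sectorDensity_pos (t := t) hα z.2).le]

theorem measurableSet_halfPlane : MeasurableSet {w : ℂ | 0 < w.re} :=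
  measurableSet_lt measurable_const Complex.measurable_re

theorem integrable_sectorMeasure_iff (hα : 0 < α) (hα2 : α ≤ 2) (Φ : ℂ → E) :
    Integrable (fun z : sector α => Φ z) (sectorMeasure α t) ↔
      IntegrableOn (fun w => halfPlaneDensity α t w • Φ (w ^ ((α / 2 : ℝ) : ℂ)))
        {w | 0 < w.re} := by
  have hb := bijOn_cpow_half hα hα2
  rw [integrable_sectorMeasure_iff_density hα]
  have h1 := integrableOn_iff_comap_subtypeVal (isOpen_sector hα2).measurableSet (μ := volume)
    (f := fun z => sectorDensity α t z • Φ z)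
  refine h1.symm.trans ?_
  rw [← hb.image_eq, integrableOn_image_iff_of_hasDerivAt measurableSet_halfPlane
    (fun w hw => hasDerivAt_cpow_half α hw) hb.injOn]
  refine integrableOn_congr_fun (fun w hw => ?_) measurableSet_halfPlane
  rw [smul_smul, norm_deriv_sq_mul_sectorDensity hα hα2 hw]

theorem integral_sectorMeasure (hα : 0 < α) (hα2 : α ≤ 2) (Φ : ℂ → E) :
    ∫ z : sector α, Φ z ∂sectorMeasure α t =
      ∫ w in {w : ℂ | 0 < w.re}, halfPlaneDensity α t w • Φ (w ^ ((α / 2 : ℝ) : ℂ)) := by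
  have hb := bijOn_cpow_half hα hα2
  rw [integral_sectorMeasure_density hα]
  have h1 := integral_subtype_comap (isOpen_sector hα2).measurableSet (μ := volume)
    (fun z => sectorDensity α t z • Φ z)
  refine h1.trans ?_
  rw [← hb.image_eq, integral_image_eq_of_hasDerivAt measurableSet_halfPlane
    (fun w hw => hasDerivAt_cpow_half α hw) hb.injOn]
  refine setIntegral_congr_fun measurableSet_halfPlane (fun w hw => ?_)
  rw [smul_smul, norm_deriv_sq_mul_sectorDensity hα hα2 hw]

end Transfer

/-! ### The reproducing kernel on the sector -/

section Reproducing

variable {α t : ℝ}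

/-- The transport of a function on the sector to the right half-plane. -/
noncomputable def halfPlaneTransport (α t : ℝ) (F : ℂ → ℂ) (w : ℂ) : ℂ :=
  F (w ^ ((α / 2 : ℝ) : ℂ)) * (w ^ ((α / 2 : ℝ) : ℂ))⁻¹ * Complex.exp ((α ^ 2 / (4 * t) : ℝ) * w)

/-- Dividing by `w ^ (α/2)` accounts for `‖w‖ ^ (-α)`, and the exponential factor in
`halfPlaneTransport` accounts for the exponential weight. Only the standard weight `Re w ^ (α - 1)`
is left. -/
theorem halfPlaneDensity_mul_mul_conj {w : ℂ} (hw : 0 < w.re) (F₁ F₂ : ℂ → ℂ) :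
    (halfPlaneDensity α t w : ℂ) *
        (F₁ (w ^ ((α / 2 : ℝ) : ℂ)) * conj (F₂ (w ^ ((α / 2 : ℝ) : ℂ)))) =
      (transferConst α : ℂ) * (halfPlaneTransport α t F₁ w *
        conj (halfPlaneTransport α t F₂ w) * ((w.re ^ (α - 1) : ℝ) : ℂ)) := by
  have hw0 : w ≠ 0 := fun h => by simp [h] at hw
  have hn : 0 < ‖w‖ := norm_pos_iff.2 hw0
  set u : ℂ := w ^ ((α / 2 : ℝ) : ℂ) with hu
  have hu0 : u ≠ 0 := by
    rw [hu, Complex.cpow_ne_zero_iff]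
    exact Or.inl hw0
  have h1 : u⁻¹ * conj u⁻¹ = ((‖w‖ ^ (-α) : ℝ) : ℂ) := by
    rw [Complex.mul_conj, Complex.normSq_eq_norm_sq, norm_inv, hu, Complex.norm_cpow_real,
      ← Real.rpow_neg hn.le, ← Real.rpow_natCast, ← Real.rpow_mul hn.le]
    congr 2
    push_cast
    ring
  have h2 : Complex.exp ((α ^ 2 / (4 * t) : ℝ) * w) *
      conj (Complex.exp ((α ^ 2 / (4 * t) : ℝ) * w)) =
      ((Real.exp (α ^ 2 / (2 * t) * w.re) : ℝ) : ℂ) := by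
    rw [← Complex.exp_conj, map_mul, Complex.conj_ofReal, ← Complex.exp_add, ← mul_add,
      Complex.add_conj, Complex.ofReal_exp]
    congr 1
    rw [← Complex.ofReal_mul]
    congr 1
    -- For `t = 0` both quotients are `0` by the division convention, so no sign condition on `t` is
    -- needed.
    by_cases ht : t = 0
    · simp [ht]
    · field_simp
      ring
  simp only [halfPlaneTransport, halfPlaneDensity, ← hu, map_mul, Complex.ofReal_mul]
  rw [← h1, ← h2]
  ring

theorem integrable_norm_sq_sectorMeasure_iff (hα : 0 < α) (hα2 : α ≤ 2) (F : ℂ → ℂ) :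
    Integrable (fun z : sector α => ‖F z‖ ^ 2) (sectorMeasure α t) ↔
      IntegrableOn (fun w => ‖halfPlaneTransport α t F w‖ ^ 2 * w.re ^ (α - 1))
        {w | 0 < w.re} := by
  rw [integrable_sectorMeasure_iff hα hα2 fun z => ‖F z‖ ^ 2]
  refine Iff.trans (integrableOn_congr_fun (fun w hw => ?_) measurableSet_halfPlane)
    (integrable_const_mul_iff (isUnit_iff_ne_zero.2 (transferConst_pos hα).ne')
      (fun w => ‖halfPlaneTransport α t F w‖ ^ 2 * w.re ^ (α - 1)))
  have h := halfPlaneDensity_mul_mul_conj (α := α) (t := t) hw F F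
  simp only [Complex.mul_conj, Complex.normSq_eq_norm_sq, ← Complex.ofReal_mul] at h
  exact Complex.ofReal_injective h

theorem integral_mul_conj_sectorMeasure (hα : 0 < α) (hα2 : α ≤ 2) (F₁ F₂ : ℂ → ℂ) :
    ∫ z : sector α, F₁ z * conj (F₂ z) ∂sectorMeasure α t =
      (transferConst α : ℂ) * ∫ w in {w : ℂ | 0 < w.re}, halfPlaneTransport α t F₁ w *
        conj (halfPlaneTransport α t F₂ w) * ((w.re ^ (α - 1) : ℝ) : ℂ) := by
  rw [integral_sectorMeasure hα hα2 fun z => F₁ z * conj (F₂ z), ← integral_const_mul]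
  refine setIntegral_congr_fun measurableSet_halfPlane (fun w hw => ?_)
  rw [Complex.real_smul]
  exact halfPlaneDensity_mul_mul_conj hw F₁ F₂

theorem differentiableOn_halfPlaneTransport (hα : 0 < α) (hα2 : α ≤ 2) {F : ℂ → ℂ}
    (hF : DifferentiableOn ℂ F (sector α)) :
    DifferentiableOn ℂ (halfPlaneTransport α t F) {w | 0 < w.re} := by
  have hb := bijOn_cpow_half hα hα2
  have h1 : DifferentiableOn ℂ (fun w : ℂ => w ^ ((α / 2 : ℝ) : ℂ)) {w | 0 < w.re} := fun w hw =>
    (hasDerivAt_cpow_half α hw).differentiableAt.differentiableWithinAt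
  refine ((hF.comp h1 hb.mapsTo).mul (h1.inv fun w hw => (hb.mapsTo hw).1)).mul ?_
  fun_prop

/-- The reproducing kernel of the image space at the point `z₀`, as a function on the plane. -/
noncomputable def sectorKernel (α t : ℝ) (z₀ z : ℂ) : ℂ :=
  ((Real.Gamma (α + 1) / Real.Gamma (α / 2) ^ 2 * (α / 2) ^ (-2 : ℝ) : ℝ) : ℂ) *
    (z * conj z₀) *
    Complex.exp (-(((α ^ 2 / (4 * t) : ℝ) : ℂ) *
      (z ^ ((2 / α : ℝ) : ℂ) + conj (z₀ ^ ((2 / α : ℝ) : ℂ))))) *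
    (z ^ ((2 / α : ℝ) : ℂ) + conj (z₀ ^ ((2 / α : ℝ) : ℂ))) ^ ((-(α + 1) : ℝ) : ℂ)

/-- The factors of `sectorKernel` that depend on `z` outside the power are those removed by the
transport, so the standard half-plane kernel remains, up to a factor depending on `z₀`. -/
theorem halfPlaneTransport_sectorKernel (hα : 0 < α) (hα2 : α ≤ 2) (z₀ : ℂ) {w : ℂ}
    (hw : 0 < w.re) :
    halfPlaneTransport α t (sectorKernel α t z₀) w =
      (((Real.Gamma (α + 1) / Real.Gamma (α / 2) ^ 2 * (α / 2) ^ (-2 : ℝ) : ℝ) : ℂ) * conj z₀ *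
        Complex.exp (-(((α ^ 2 / (4 * t) : ℝ) : ℂ) * conj (z₀ ^ ((2 / α : ℝ) : ℂ))))) *
      (w + conj (z₀ ^ ((2 / α : ℝ) : ℂ))) ^ ((-(α + 1) : ℝ) : ℂ) := by
  have hu0 : w ^ ((α / 2 : ℝ) : ℂ) ≠ 0 := ((bijOn_cpow_half hα hα2).mapsTo hw).1
  simp only [halfPlaneTransport, sectorKernel, cpow_half_cpow_two_div hα hα2 hw]
  rw [mul_add, neg_add, Complex.exp_add, Complex.exp_neg (_ * w)]
  field_simp

theorem differentiableOn_sectorKernel (hα : 0 < α) (hα2 : α ≤ 2) {z₀ : ℂ} (hz₀ : z₀ ∈ sector α) :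
    DifferentiableOn ℂ (sectorKernel α t z₀) (sector α) := by
  have h1 : DifferentiableOn ℂ (fun z : ℂ => z ^ ((2 / α : ℝ) : ℂ)) (sector α) := fun z hz =>
    (differentiableAt_id.cpow (differentiableAt_const _)
      (mem_slitPlane_of_mem_sector hα2 hz)).differentiableWithinAt
  have h2 : DifferentiableOn ℂ (fun z : ℂ => (z ^ ((2 / α : ℝ) : ℂ) +
      conj (z₀ ^ ((2 / α : ℝ) : ℂ))) ^ ((-(α + 1) : ℝ) : ℂ)) (sector α) := by
    refine (h1.add_const _).cpow (by fun_prop) fun z hz => Or.inl ?_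
    have := rePow_pos hα hz
    have := rePow_pos hα hz₀
    rw [rePow] at *
    rw [Complex.add_re, Complex.conj_re]
    positivity
  unfold sectorKernel
  exact DifferentiableOn.mul (by fun_prop) h2

theorem integrable_norm_sq_sectorKernel (hα : 0 < α) (hα2 : α ≤ 2) {z₀ : ℂ}
    (hz₀ : z₀ ∈ sector α) :
    Integrable (fun z : sector α => ‖sectorKernel α t z₀ z‖ ^ 2) (sectorMeasure α t) := by
  rw [integrable_norm_sq_sectorMeasure_iff hα hα2]
  have h1 := (integrableOn_halfPlane_kernel hα (rePow_pos hα hz₀)).const_mul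
    (‖((Real.Gamma (α + 1) / Real.Gamma (α / 2) ^ 2 * (α / 2) ^ (-2 : ℝ) : ℝ) : ℂ) * conj z₀ *
        Complex.exp (-(((α ^ 2 / (4 * t) : ℝ) : ℂ) * conj (z₀ ^ ((2 / α : ℝ) : ℂ))))‖ ^ 2)
  refine IntegrableOn.congr_fun h1 (fun w hw => ?_) measurableSet_halfPlane
  conv_rhs => rw [halfPlaneTransport_sectorKernel hα hα2 z₀ hw, norm_mul, mul_pow, mul_assoc]

/-- This normalization makes the kernel reproduce exactly: it reduces to `B(α/2, α/2) = Γ(α/2)² /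
Γ(α)` and `Γ(α + 1) = α Γ(α)`. -/
theorem transferConst_mul_kernelConst (hα : 0 < α) :
    transferConst α * (Real.Gamma (α + 1) / Real.Gamma (α / 2) ^ 2 * (α / 2) ^ (-2 : ℝ)) *
      (Real.pi * 2 ^ (1 - α) / α) = 1 := by
  have h1 : 0 < Real.Gamma (α / 2) := Real.Gamma_pos_of_pos (by positivity)
  have h2 : 0 < Real.Gamma α := Real.Gamma_pos_of_pos hα
  have h3 : (2 : ℝ) ^ (1 - α) = (2 ^ (α - 1))⁻¹ := by
    rw [← Real.rpow_neg two_pos.le, neg_sub]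
  have h4 : (α / 2) ^ (-2 : ℝ) = ((α / 2) ^ 2)⁻¹ := by
    rw [Real.rpow_neg (by positivity)]
    norm_cast
  rw [transferConst, ProbabilityTheory.beta, add_halves, h3, h4, Real.Gamma_add_one hα.ne']
  have : (2 : ℝ) ^ (α - 1) ≠ 0 := by positivity
  field_simp

/-- The reproducing formula of the image space. -/
theorem sector_reproducing (hα : 0 < α) (hα2 : α ≤ 2) {F : ℂ → ℂ}
    (hF : DifferentiableOn ℂ F (sector α))
    (hint : Integrable (fun z : sector α => ‖F z‖ ^ 2) (sectorMeasure α t)) {z₀ : ℂ}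
    (hz₀ : z₀ ∈ sector α) :
    ∫ z : sector α, F z * conj (sectorKernel α t z₀ z) ∂sectorMeasure α t = F z₀ := by
  have hw₀ : 0 < (z₀ ^ ((2 / α : ℝ) : ℂ)).re := rePow_pos hα hz₀
  rw [integrable_norm_sq_sectorMeasure_iff hα hα2] at hint
  have h1 := halfPlane_reproducing hα (differentiableOn_halfPlaneTransport hα hα2 hF) hint hw₀
  rw [integral_mul_conj_sectorMeasure hα hα2]
  have h2 : ∀ w ∈ {w : ℂ | 0 < w.re}, halfPlaneTransport α t F w *
      conj (halfPlaneTransport α t (sectorKernel α t z₀) w) * ((w.re ^ (α - 1) : ℝ) : ℂ) =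
      (((Real.Gamma (α + 1) / Real.Gamma (α / 2) ^ 2 * (α / 2) ^ (-2 : ℝ) : ℝ) : ℂ) * z₀ *
        Complex.exp (-(((α ^ 2 / (4 * t) : ℝ) : ℂ) * z₀ ^ ((2 / α : ℝ) : ℂ)))) *
      (halfPlaneTransport α t F w *
      conj ((w + conj (z₀ ^ ((2 / α : ℝ) : ℂ))) ^ ((-(α + 1) : ℝ) : ℂ)) *
        ((w.re ^ (α - 1) : ℝ) : ℂ)) := by
    intro w hw
    rw [halfPlaneTransport_sectorKernel hα hα2 z₀ hw]
    generalize (w + conj (z₀ ^ ((2 / α : ℝ) : ℂ))) ^ ((-(α + 1) : ℝ) : ℂ) = q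
    simp only [map_mul, Complex.conj_ofReal, Complex.conj_conj, ← Complex.exp_conj, map_neg]
    ring
  -- The factors `z₀` and `exp` pulled out of the kernel cancel those that the transport attaches to
  -- `F z₀`; the constants then multiply to `1`.
  rw [setIntegral_congr_fun measurableSet_halfPlane h2, integral_const_mul, h1,
    halfPlaneTransport, cpow_two_div_cpow_half hα hz₀, Complex.exp_neg]
  have h3 := congrArg (fun r : ℝ => (r : ℂ)) (transferConst_mul_kernelConst hα)
  simp only [Complex.ofReal_mul _ (Real.pi * 2 ^ (1 - α) / α), Complex.ofReal_mul (transferConst α),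
    Complex.ofReal_one] at h3
  have he := Complex.exp_ne_zero (((α ^ 2 / (4 * t) : ℝ) : ℂ) * z₀ ^ ((2 / α : ℝ) : ℂ))
  have hz0 := hz₀.1
  generalize Complex.exp (((α ^ 2 / (4 * t) : ℝ) : ℂ) * z₀ ^ ((2 / α : ℝ) : ℂ)) = e at he ⊢
  generalize ((transferConst α : ℝ) : ℂ) = a at h3 ⊢
  generalize ((Real.Gamma (α + 1) / Real.Gamma (α / 2) ^ 2 * (α / 2) ^ (-2 : ℝ) : ℝ) : ℂ) = b
    at h3 ⊢
  generalize ((Real.pi * 2 ^ (1 - α) / α : ℝ) : ℂ) = c at h3 ⊢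
  field_simp
  linear_combination F z₀ * h3

end Reproducing

/-! ### The Laplace transform of a power -/

section GammaIntegral

theorem integrableOn_rpow_mul_exp_neg_mul {p b : ℝ} (hp : -1 < p) (hb : 0 < b) :
    IntegrableOn (fun s : ℝ => s ^ p * Real.exp (-b * s)) (Set.Ioi 0) := by
  simpa using integrableOn_rpow_mul_exp_neg_mul_rpow hp zero_lt_one hb

theorem norm_ofReal_rpow_mul_exp {p s : ℝ} (hs : 0 < s) (β : ℂ) :
    ‖((s ^ p : ℝ) : ℂ) * Complex.exp (-β * s)‖ = s ^ p * Real.exp (-β.re * s) := by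
  rw [norm_mul, Complex.norm_real, Real.norm_of_nonneg (by positivity), Complex.norm_exp]
  simp

theorem aestronglyMeasurable_rpow_mul_exp (p : ℝ) (β : ℂ) (μ : Measure ℝ) :
    AEStronglyMeasurable (fun s : ℝ => ((s ^ p : ℝ) : ℂ) * Complex.exp (-β * s)) μ := by
  refine Measurable.aestronglyMeasurable ?_
  fun_prop

theorem integrableOn_rpow_mul_cexp {p : ℝ} (hp : -1 < p) {β : ℂ} (hβ : 0 < β.re) :
    IntegrableOn (fun s : ℝ => ((s ^ p : ℝ) : ℂ) * Complex.exp (-β * s)) (Set.Ioi 0) := by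
  refine Integrable.mono' (integrableOn_rpow_mul_exp_neg_mul hp hβ)
    (aestronglyMeasurable_rpow_mul_exp _ _ _) ?_
  refine (ae_restrict_iff' measurableSet_Ioi).2 (.of_forall fun s hs => ?_)
  exact (norm_ofReal_rpow_mul_exp hs β).le

theorem differentiableOn_integral_rpow_mul_cexp {p : ℝ} (hp : -1 < p) :
    DifferentiableOn ℂ (fun β : ℂ => ∫ s in Set.Ioi (0 : ℝ), ((s ^ p : ℝ) : ℂ) *
      Complex.exp (-β * s)) {β | 0 < β.re} := by
  intro β hβ
  have hβ' : 0 < β.re / 2 := half_pos hβ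
  have hder : ∀ s : ℝ, ∀ x : ℂ, HasDerivAt (fun x : ℂ => ((s ^ p : ℝ) : ℂ) * Complex.exp (-x * s))
      (((s ^ p : ℝ) : ℂ) * (Complex.exp (-x * s) * (-s))) x := by
    intro s x
    have h1 : HasDerivAt (fun x : ℂ => -x * (s : ℂ)) (-(s : ℂ)) x := by
      simpa using ((hasDerivAt_id x).neg.mul_const (s : ℂ))
    exact h1.cexp.const_mul _
  -- On the ball of radius `β.re / 2` about `β` real parts stay above `β.re / 2`, which dominates
  -- the derivative uniformly.
  refine (hasDerivAt_integral_of_dominated_loc_of_deriv_le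
    (F := fun (x : ℂ) (s : ℝ) => ((s ^ p : ℝ) : ℂ) * Complex.exp (-x * s))
    (F' := fun x s => ((s ^ p : ℝ) : ℂ) * (Complex.exp (-x * s) * (-s)))
    (bound := fun s => s ^ (p + 1) * Real.exp (-(β.re / 2) * s))
    (Metric.ball_mem_nhds β hβ') (.of_forall fun x => aestronglyMeasurable_rpow_mul_exp _ _ _)
    (integrableOn_rpow_mul_cexp hp hβ) ?_ ?_
    (integrableOn_rpow_mul_exp_neg_mul (by linarith) hβ') ?_).2.differentiableAt.differentiableWithinAt
  · refine Measurable.aestronglyMeasurable ?_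
    fun_prop
  · refine (ae_restrict_iff' measurableSet_Ioi).2 (.of_forall fun s hs x hx => ?_)
    have hs' : 0 < s := hs
    have hx' : β.re / 2 ≤ x.re := by
      rw [Metric.mem_ball, dist_eq_norm] at hx
      have := (Complex.abs_re_le_norm (x - β)).trans_lt hx
      rw [Complex.sub_re, abs_lt] at this
      linarith
    rw [← mul_assoc, norm_mul, norm_ofReal_rpow_mul_exp hs', norm_neg, Complex.norm_real,
      Real.norm_of_nonneg hs'.le, Real.rpow_add_one hs'.ne', mul_right_comm]
    gcongr
  · exact .of_forall fun s x _ => hder s x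

/-- The Laplace transform of a power, for complex parameters in the right half-plane. -/
theorem integral_rpow_mul_cexp {p : ℝ} (hp : -1 < p) {β : ℂ} (hβ : 0 < β.re) :
    ∫ s in Set.Ioi (0 : ℝ), ((s ^ p : ℝ) : ℂ) * Complex.exp (-β * s) =
      (Real.Gamma (p + 1) : ℂ) * β ^ ((-(p + 1) : ℝ) : ℂ) := by
  have hopen : IsOpen {β : ℂ | 0 < β.re} := isOpen_lt continuous_const Complex.continuous_re
  have hconn : IsPreconnected {β : ℂ | 0 < β.re} := (convex_halfSpace_re_gt 0).isPreconnected
  have h1 := (differentiableOn_integral_rpow_mul_cexp hp).analyticOnNhd hopen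
  have h2 : AnalyticOnNhd ℂ (fun β : ℂ => (Real.Gamma (p + 1) : ℂ) * β ^ ((-(p + 1) : ℝ) : ℂ))
      {β | 0 < β.re} := by
    refine DifferentiableOn.analyticOnNhd ?_ hopen
    exact (differentiableOn_id.cpow (by fun_prop) fun z hz => Or.inl hz).const_mul _
  have hreal : ∀ r : ℝ, 0 < r → ∫ s in Set.Ioi (0 : ℝ), ((s ^ p : ℝ) : ℂ) *
      Complex.exp (-(r : ℂ) * s) = (Real.Gamma (p + 1) : ℂ) * (r : ℂ) ^ ((-(p + 1) : ℝ) : ℂ) := by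
    intro r hr
    have h3 := Real.integral_rpow_mul_exp_neg_mul_Ioi (a := p + 1) (by linarith) hr
    rw [add_sub_cancel_right] at h3
    rw [← Complex.ofReal_cpow hr.le, ← Complex.ofReal_mul, mul_comm (Real.Gamma _),
      Real.rpow_neg hr.le, ← Real.inv_rpow hr.le, ← one_div, ← h3]
    rw [← integral_complex_ofReal]
    refine integral_congr_ae (.of_forall fun s => ?_)
    push_cast
    ring_nf
  -- Both sides are analytic on the half-plane and agree on the positive axis, which accumulates at
  -- `1`; the identity theorem does the rest.
  have hfreq : ∃ᶠ z in 𝓝[≠] (1 : ℂ), ∫ s in Set.Ioi (0 : ℝ), ((s ^ p : ℝ) : ℂ) *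
      Complex.exp (-z * s) = (Real.Gamma (p + 1) : ℂ) * z ^ ((-(p + 1) : ℝ) : ℂ) := by
    have ht : Tendsto (fun r : ℝ => (r : ℂ)) (𝓝[≠] (1 : ℝ)) (𝓝[≠] (1 : ℂ)) := by
      refine tendsto_nhdsWithin_of_tendsto_nhds_of_eventually_within _ ?_ ?_
      · exact (Complex.continuous_ofReal.tendsto' 1 1 (by simp)).mono_left nhdsWithin_le_nhds
      · filter_upwards [self_mem_nhdsWithin] with r hr
        simpa using hr
    refine ht.frequently (Eventually.frequently ?_)
    filter_upwards [nhdsWithin_le_nhds (lt_mem_nhds one_pos)] with r hr using hreal r hr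
  exact h1.eqOn_of_preconnected_of_frequently_eq h2 hconn (by simp) hfreq hβ

end GammaIntegral

/-! ### The Gamma integral on a finite interval -/

section BetaTypeIntegral

/-- The Gamma type integral on a finite interval that comes from `s = 1 / (t - τ) - 1 / t`. -/
theorem integral_Ioo_rpow_mul_cexp_div {p t : ℝ} (hp : -1 < p) (ht : 0 < t) {β : ℂ}
    (hβ : 0 < β.re) :
    ∫ τ in Set.Ioo 0 t, ((τ ^ p / (t - τ) ^ (p + 2) : ℝ) : ℂ) *
        Complex.exp (-β / ((t : ℂ) - τ)) =
      (t ^ p : ℝ) * Complex.exp (-β / t) *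
        ((Real.Gamma (p + 1) : ℂ) * β ^ ((-(p + 1) : ℝ) : ℂ)) := by
  let φ : ℝ → ℝ := fun s => t - (s + t⁻¹)⁻¹
  have hpos : ∀ s ∈ Set.Ioi (0 : ℝ), 0 < s + t⁻¹ := fun s hs => by
    have : 0 < s := hs
    positivity
  have hφ : ∀ s ∈ Set.Ioi (0 : ℝ), HasDerivWithinAt φ (((s + t⁻¹) ^ 2)⁻¹) (Set.Ioi 0) s := by
    intro s hs
    have h1 : HasDerivAt (fun s => s + t⁻¹) 1 s := (hasDerivAt_id s).add_const _
    have h2 := (h1.fun_inv (hpos s hs).ne').const_sub t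
    refine HasDerivAt.hasDerivWithinAt ?_
    convert! h2 using 1
    rw [neg_div, neg_neg, one_div]
  have hinj : Set.InjOn φ (Set.Ioi 0) := by
    intro s _ s' _ h
    exact add_right_cancel (inv_injective (sub_right_injective h))
  have himg : φ '' Set.Ioi 0 = Set.Ioo 0 t := by
    ext τ
    constructor
    · rintro ⟨s, hs, rfl⟩
      have h1 := hpos s hs
      have hs' : 0 < s := hs
      refine ⟨sub_pos.2 ?_, sub_lt_self _ (by positivity)⟩
      rw [inv_lt_comm₀ h1 ht]
      linarith
    · intro hτ
      have h1 : 0 < t - τ := sub_pos.2 hτ.2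
      refine ⟨(t - τ)⁻¹ - t⁻¹, ?_, by simp [φ]⟩
      have : t - τ < t := by linarith [hτ.1]
      exact sub_pos.2 ((inv_lt_inv₀ ht h1).2 this)
  rw [← himg, integral_image_eq_integral_abs_deriv_smul measurableSet_Ioi hφ hinj,
    ← integral_rpow_mul_cexp hp hβ, ← integral_const_mul]
  refine setIntegral_congr_fun measurableSet_Ioi fun s hs => ?_
  have h1 := hpos s hs
  have hs' : 0 < s := hs
  have hsub : t - φ s = (s + t⁻¹)⁻¹ := by simp [φ]
  have hmul : φ s = t * s * (s + t⁻¹)⁻¹ := by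
    simp only [φ]
    field_simp
    ring
  have hcast : (t : ℂ) - (φ s : ℂ) = (((s + t⁻¹)⁻¹ : ℝ) : ℂ) := by
    rw [← Complex.ofReal_sub, hsub]
  -- The exponent `p + 2` is the one for which all powers of `s + t⁻¹`, including the Jacobian,
  -- cancel.
  have hreal : ((s + t⁻¹) ^ 2)⁻¹ * (φ s ^ p / (t - φ s) ^ (p + 2)) = t ^ p * s ^ p := by
    rw [hsub, hmul, Real.mul_rpow (by positivity) (by positivity), Real.mul_rpow ht.le hs'.le,
      Real.rpow_add (by positivity), Real.inv_rpow h1.le]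
    have : (s + t⁻¹) ^ p ≠ 0 := by positivity
    norm_num
    field_simp
  rw [abs_of_pos (by positivity), Complex.real_smul, ← mul_assoc, ← Complex.ofReal_mul, hreal,
    hcast, Complex.ofReal_mul]
  have hexp : -β / (((s + t⁻¹)⁻¹ : ℝ) : ℂ) = -β / t + -β * s := by
    push_cast
    have : (t : ℂ) ≠ 0 := by exact_mod_cast ht.ne'
    rw [div_inv_eq_mul]
    field_simp
    ring
  rw [hexp, Complex.exp_add]
  ring

end BetaTypeIntegral

/-! ### Uniqueness for Fourier transforms -/

section Uniqueness

/-- An integrable real function whose characteristic function along an injective map vanishes is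
zero. -/
theorem ae_eq_zero_of_integral_mul_cexp_eq_zero_real {X : Type*} [MeasurableSpace X]
    {ν : Measure X} {h : X → ℝ} (hh : Integrable h ν) {ψ : X → ℝ} (hψ : MeasurableEmbedding ψ)
    (h0 : ∀ x : ℝ, ∫ τ, (h τ : ℂ) * Complex.exp (x * ψ τ * Complex.I) ∂ν = 0) : h =ᵐ[ν] 0 := by
  let p : X → ℝ := fun τ => max (h τ) 0
  let n : X → ℝ := fun τ => max (-h τ) 0
  have hp : Integrable p ν := hh.pos_part
  have hn : Integrable n ν := hh.neg_part
  have hfin : ∀ {q : X → ℝ}, Integrable q ν →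
      IsFiniteMeasure (ν.withDensity fun τ => ENNReal.ofReal (q τ)) := fun hq =>
    isFiniteMeasure_withDensity_ofReal hq.2
  have hchar : ∀ {q : X → ℝ}, Integrable q ν → (∀ τ, 0 ≤ q τ) → ∀ x : ℝ,
      charFun ((ν.withDensity fun τ => ENNReal.ofReal (q τ)).map ψ) x =
        ∫ τ, (q τ : ℂ) * Complex.exp (x * ψ τ * Complex.I) ∂ν := by
    intro q hq hq0 x
    rw [charFun_apply_real, hψ.integral_map,
      integral_withDensity_eq_integral_toReal_smul₀ hq.1.aemeasurable.ennreal_ofReal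
        (.of_forall fun τ => ENNReal.ofReal_lt_top)]
    simp only [ENNReal.toReal_ofReal (hq0 _), Complex.real_smul]
  have hosc : ∀ {q : X → ℝ}, Integrable q ν → ∀ x : ℝ,
      Integrable (fun τ => (q τ : ℂ) * Complex.exp (x * ψ τ * Complex.I)) ν := by
    intro q hq x
    refine hq.ofReal.mul_bdd (c := 1) ?_ (.of_forall fun τ => ?_)
    · have := hψ.measurable
      exact (by fun_prop : Measurable fun τ =>
        Complex.exp (x * ψ τ * Complex.I)).aestronglyMeasurable
    · rw [← Complex.ofReal_mul, Complex.norm_exp_ofReal_mul_I]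
  have := hfin hp
  have := hfin hn
  -- The positive and negative parts give finite measures whose images under `ψ` have equal
  -- characteristic functions. The images therefore coincide, and the embedding `ψ` pulls this
  -- equality back.
  have hmap : (ν.withDensity fun τ => ENNReal.ofReal (p τ)).map ψ =
      (ν.withDensity fun τ => ENNReal.ofReal (n τ)).map ψ := by
    refine Measure.ext_of_charFun (funext fun x => ?_)
    rw [hchar hp (fun τ => le_max_right _ _), hchar hn (fun τ => le_max_right _ _), ← sub_eq_zero,
      ← integral_sub (hosc hp x) (hosc hn x), ← h0 x]
    refine integral_congr_ae (.of_forall fun τ => ?_)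
    simp only [← sub_mul, ← Complex.ofReal_sub]
    congr 2
    rcases le_total 0 (h τ) with h1 | h1 <;> simp [p, n, h1]
  have hden : (ν.withDensity fun τ => ENNReal.ofReal (p τ)) =
      ν.withDensity fun τ => ENNReal.ofReal (n τ) := by
    have := congrArg (Measure.comap ψ) hmap
    rwa [hψ.comap_map, hψ.comap_map] at this
  have hae := (withDensity_eq_iff hp.1.aemeasurable.ennreal_ofReal
    hn.1.aemeasurable.ennreal_ofReal
    (by simpa using (measure_lt_top (ν.withDensity fun τ => ENNReal.ofReal (p τ)) Set.univ).ne)).1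
    hden
  filter_upwards [hae] with τ hτ
  rw [ENNReal.ofReal_eq_ofReal_iff (le_max_right _ _) (le_max_right _ _)] at hτ
  rcases le_total 0 (h τ) with h1 | h1
  · simpa [p, n, h1] using hτ
  · simpa [p, n, h1] using hτ.symm

theorem ae_eq_zero_of_integral_mul_cexp_eq_zero {X : Type*} [MeasurableSpace X]
    {ν : Measure X} {G : X → ℂ} (hG : Integrable G ν) {ψ : X → ℝ} (hψ : MeasurableEmbedding ψ)
    (h0 : ∀ x : ℝ, ∫ τ, G τ * Complex.exp (x * ψ τ * Complex.I) ∂ν = 0) : G =ᵐ[ν] 0 := by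
  have hosc : ∀ {q : X → ℂ}, Integrable q ν → ∀ x : ℝ,
      Integrable (fun τ => q τ * Complex.exp (x * ψ τ * Complex.I)) ν := by
    intro q hq x
    refine hq.mul_bdd (c := 1) ?_ (.of_forall fun τ => ?_)
    · have := hψ.measurable
      exact (by fun_prop : Measurable fun τ =>
        Complex.exp (x * ψ τ * Complex.I)).aestronglyMeasurable
    · rw [← Complex.ofReal_mul, Complex.norm_exp_ofReal_mul_I]
  have hGc : Integrable (fun τ => conj (G τ)) ν :=
    Complex.conjCLE.toContinuousLinearMap.integrable_comp hG
  -- Conjugating the hypothesis at `-x` gives the same vanishing for `conj G`, hence for the real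
  -- and imaginary parts.
  have hconj : ∀ x : ℝ, ∫ τ, conj (G τ) * Complex.exp (x * ψ τ * Complex.I) ∂ν = 0 := by
    intro x
    have h1 := congrArg conj (h0 (-x))
    rw [← integral_conj, map_zero] at h1
    rw [← h1]
    refine integral_congr_ae (.of_forall fun τ => ?_)
    simp only [map_mul, ← Complex.exp_conj, Complex.conj_ofReal, Complex.conj_I]
    congr 2
    push_cast
    ring
  have hre : (fun τ => (G τ).re) =ᵐ[ν] 0 := by
    refine ae_eq_zero_of_integral_mul_cexp_eq_zero_real hG.re hψ fun x => ?_
    have h1 : ∀ τ, ((G τ).re : ℂ) * Complex.exp (x * ψ τ * Complex.I) =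
        (1 / 2 : ℂ) * (G τ * Complex.exp (x * ψ τ * Complex.I) +
          conj (G τ) * Complex.exp (x * ψ τ * Complex.I)) := fun τ => by
      rw [← add_mul, Complex.add_conj]
      push_cast
      ring
    simp only [h1]
    rw [integral_const_mul, integral_add (hosc hG x) (hosc hGc x), h0, hconj]
    simp
  have him : (fun τ => (G τ).im) =ᵐ[ν] 0 := by
    refine ae_eq_zero_of_integral_mul_cexp_eq_zero_real hG.im hψ fun x => ?_
    have h1 : ∀ τ, ((G τ).im : ℂ) * Complex.exp (x * ψ τ * Complex.I) =
        (1 / (2 * Complex.I) : ℂ) * (G τ * Complex.exp (x * ψ τ * Complex.I) -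
          conj (G τ) * Complex.exp (x * ψ τ * Complex.I)) := fun τ => by
      rw [← sub_mul, Complex.sub_conj]
      have := Complex.I_ne_zero
      push_cast
      field_simp
    simp only [h1]
    rw [integral_const_mul, integral_sub (hosc hG x) (hosc hGc x), h0, hconj]
    simp
  filter_upwards [hre, him] with τ h1 h2
  exact Complex.ext h1 h2

end Uniqueness

/-! ### The data measure -/

section DataMeasure

variable {α t : ℝ} {E : Type*} [NormedAddCommGroup E] [NormedSpace ℝ E]

theorem measurable_dataDensity (α t : ℝ) :
    Measurable fun τ : ℝ => ENNReal.ofReal (τ ^ α / t ^ α) := by fun_prop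

theorem toReal_dataDensity {τ : ℝ} (hτ : τ ∈ Set.Ioo 0 t) :
    (ENNReal.ofReal (τ ^ α / t ^ α)).toReal = τ ^ α / t ^ α := by
  have h1 := hτ.1
  have h2 := hτ.1.trans hτ.2
  exact ENNReal.toReal_ofReal (by positivity)

theorem isFiniteMeasure_dataMeasure (hα : 0 < α) (ht : 0 < t) :
    IsFiniteMeasure (dataMeasure α t) := by
  refine ⟨?_⟩
  rw [dataMeasure, withDensity_apply _ MeasurableSet.univ, Measure.restrict_univ]
  calc ∫⁻ τ in Set.Ioo 0 t, ENNReal.ofReal (τ ^ α / t ^ α)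
      ≤ ∫⁻ τ in Set.Ioo 0 t, 1 := by
        refine setLIntegral_mono measurable_const fun τ hτ => ?_
        rw [ENNReal.ofReal_le_one]
        exact div_le_one_of_le₀ (Real.rpow_le_rpow hτ.1.le hτ.2.le hα.le) (by positivity)
    _ < ⊤ := by simp

theorem ae_dataMeasure_mem (α t : ℝ) : ∀ᵐ τ ∂dataMeasure α t, τ ∈ Set.Ioo 0 t :=
  (withDensity_absolutelyContinuous _ _).ae_le (ae_restrict_mem measurableSet_Ioo)

theorem integrable_dataMeasure_iff (φ : ℝ → E) :
    Integrable φ (dataMeasure α t) ↔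
      IntegrableOn (fun τ => (τ ^ α / t ^ α) • φ τ) (Set.Ioo 0 t) := by
  rw [dataMeasure, integrable_withDensity_iff_integrable_smul' (measurable_dataDensity α t)
    (.of_forall fun _ => ENNReal.ofReal_lt_top)]
  refine integrableOn_congr_fun (fun τ hτ => ?_) measurableSet_Ioo
  simp only [toReal_dataDensity hτ]

theorem integral_dataMeasure (φ : ℝ → E) :
    ∫ τ, φ τ ∂dataMeasure α t = ∫ τ in Set.Ioo 0 t, (τ ^ α / t ^ α) • φ τ := by
  rw [dataMeasure, integral_withDensity_eq_integral_toReal_smul (measurable_dataDensity α t)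
    (.of_forall fun _ => ENNReal.ofReal_lt_top)]
  refine setIntegral_congr_fun measurableSet_Ioo fun τ hτ => ?_
  simp only [toReal_dataDensity hτ]

end DataMeasure

/-! ### The operator as a feature map -/

section OperatorKernel

variable {α t : ℝ}

/-- The kernel of the operator `L_t^α`, without its constant. -/
noncomputable def operatorKernel (α t : ℝ) (z : ℂ) (τ : ℝ) : ℂ :=
  z / (((t - τ) ^ (α / 2 + 1) : ℝ) : ℂ) *
    Complex.exp (-((α : ℂ) ^ 2 * z ^ ((2 / α : ℝ) : ℂ)) / (4 * ((t : ℂ) - (τ : ℂ))))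

/-- The normalizing constant of the operator `L_t^α`. -/
noncomputable def operatorConst (α : ℝ) : ℝ := (α / 2) ^ α / Real.Gamma (α / 2)

theorem operatorConst_pos (hα : 0 < α) : 0 < operatorConst α :=
  div_pos (by positivity) (Real.Gamma_pos_of_pos (by positivity))

theorem measurable_operatorKernel (α t : ℝ) :
    Measurable fun p : ℂ × ℝ => operatorKernel α t p.1 p.2 := by
  unfold operatorKernel
  fun_prop

theorem norm_operatorKernel {z : ℂ} {τ : ℝ} (hτ : τ < t) :
    ‖operatorKernel α t z τ‖ = ‖z‖ * ((t - τ)⁻¹ ^ (α / 2 + 1) *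
      Real.exp (-(α ^ 2 * rePow α z / 4 * (t - τ)⁻¹))) := by
  have h1 : 0 < t - τ := sub_pos.2 hτ
  rw [operatorKernel, norm_mul, norm_div, Complex.norm_real, Real.norm_of_nonneg (by positivity),
    Complex.norm_exp, Real.inv_rpow h1.le, div_eq_mul_inv, mul_assoc]
  congr 4
  have h2 : -((α : ℂ) ^ 2 * z ^ ((2 / α : ℝ) : ℂ)) / (4 * ((t : ℂ) - (τ : ℂ))) =
      ((-(α ^ 2 / 4 * (t - τ)⁻¹) : ℝ) : ℂ) * z ^ ((2 / α : ℝ) : ℂ) := by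
    push_cast
    rw [div_eq_mul_inv, mul_inv]
    ring
  rw [h2, Complex.re_ofReal_mul, rePow]
  ring

/-- Raise `x ≤ exp x`, at `x = c * u / p`, to the power `p`. -/
theorem rpow_mul_exp_neg_le {p c u : ℝ} (hp : 0 < p) (hc : 0 < c) (hu : 0 < u) :
    u ^ p * Real.exp (-(c * u)) ≤ (p / c) ^ p := by
  have h1 : (c * u / p) ^ p ≤ Real.exp (c * u) := by
    calc (c * u / p) ^ p ≤ Real.exp (c * u / p) ^ p := by
          refine Real.rpow_le_rpow (by positivity) ?_ hp.le
          linarith [Real.add_one_le_exp (c * u / p)]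
      _ = Real.exp (c * u) := by
          rw [← Real.exp_mul, div_mul_cancel₀ _ hp.ne']
  have h2 : u ^ p = (p / c) ^ p * (c * u / p) ^ p := by
    rw [← Real.mul_rpow (by positivity) (by positivity)]
    congr 1
    field_simp
  rw [h2, Real.exp_neg, mul_assoc]
  exact mul_le_of_le_one_right (by positivity)
    (mul_inv_le_one_of_le₀ h1 (Real.exp_pos _).le)

theorem continuous_rePow_sector (hα2 : α ≤ 2) : Continuous fun z : sector α => rePow α z := by
  refine Complex.continuous_re.comp (continuous_iff_continuousAt.2 fun z => ?_)
  exact continuousAt_subtype_val.cpow continuousAt_const (mem_slitPlane_of_mem_sector hα2 z.2)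

/-- On a compact set `‖z‖` is bounded and `Re z ^ (2/α)` is bounded below by some `δ > 0`. The
exponential then beats the singularity at `τ = t` uniformly. This bound underlies square
integrability, holomorphy and Fubini later. -/
theorem exists_norm_operatorKernel_le (hα : 0 < α) (hα2 : α ≤ 2) {E : Set (sector α)}
    (hE : IsCompact E) :
    ∃ M, ∀ z ∈ E, ∀ τ ∈ Set.Ioo 0 t, ‖operatorKernel α t z τ‖ ≤ M := by
  obtain ⟨R, hR⟩ := hE.exists_bound_of_continuousOn
    (f := fun z : sector α => (z : ℂ)) continuous_subtype_val.continuousOn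
  obtain ⟨δ, hδ, hδE⟩ := hE.exists_forall_le' (continuous_rePow_sector hα2).continuousOn
    (fun z _ => rePow_pos hα z.2)
  refine ⟨R * ((α / 2 + 1) / (α ^ 2 * δ / 4)) ^ (α / 2 + 1), fun z hz τ hτ => ?_⟩
  have h1 : 0 < t - τ := sub_pos.2 hτ.2
  have hR0 : 0 ≤ R := (norm_nonneg _).trans (hR z hz)
  rw [norm_operatorKernel hτ.2]
  refine mul_le_mul (hR z hz) ?_ (by positivity) hR0
  refine le_trans ?_ (rpow_mul_exp_neg_le (by positivity) (by positivity) (inv_pos.2 h1))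
  have := hδE z hz
  gcongr

theorem exists_norm_operatorKernel_le_of_mem (hα : 0 < α) (hα2 : α ≤ 2) (z : sector α) :
    ∃ M, ∀ τ ∈ Set.Ioo 0 t, ‖operatorKernel α t z τ‖ ≤ M := by
  obtain ⟨M, hM⟩ := exists_norm_operatorKernel_le (t := t) hα hα2 (isCompact_singleton (x := z))
  exact ⟨M, hM z rfl⟩

/-- The functions that represent the point evaluations of `L_t^α`. -/
noncomputable def featureFun (α t : ℝ) (z : ℂ) (τ : ℝ) : ℂ :=
  conj ((operatorConst α : ℂ) * operatorKernel α t z τ)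

theorem memLp_featureFun (hα : 0 < α) (hα2 : α ≤ 2) (ht : 0 < t) (z : sector α) :
    MemLp (featureFun α t z) 2 (dataMeasure α t) := by
  have := isFiniteMeasure_dataMeasure hα ht
  obtain ⟨M, hM⟩ := exists_norm_operatorKernel_le_of_mem (t := t) hα hα2 z
  refine MemLp.of_bound (C := operatorConst α * M) ?_ ?_
  · have := (measurable_operatorKernel α t).comp (measurable_prodMk_left (x := (z : ℂ)))
    exact (Complex.continuous_conj.measurable.comp (this.const_mul _)).aestronglyMeasurable
  · filter_upwards [ae_dataMeasure_mem α t] with τ hτ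
    rw [featureFun, RCLike.norm_conj, norm_mul, Complex.norm_real,
      Real.norm_of_nonneg (operatorConst_pos hα).le]
    exact mul_le_mul_of_nonneg_left (hM τ hτ) (operatorConst_pos hα).le

theorem operatorIntegrand_eq (α t : ℝ) (g : ℝ → ℂ) (z : ℂ) (τ : ℝ) :
    (τ ^ α / t ^ α) • (g τ * conj (featureFun α t z τ)) =
      (((operatorConst α / t ^ α : ℝ)) : ℂ) * operatorIntegrand α t g z τ := by
  rw [featureFun, Complex.conj_conj, operatorIntegrand, operatorKernel, Complex.real_smul]
  push_cast
  ring

theorem integrable_mul_featureFun_iff (hα : 0 < α) (ht : 0 < t) (g : ℝ → ℂ) (z : ℂ) :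
    Integrable (fun τ => g τ * conj (featureFun α t z τ)) (dataMeasure α t) ↔
      IntegrableOn (operatorIntegrand α t g z) (Set.Ioo 0 t) := by
  have hc : (((operatorConst α / t ^ α : ℝ)) : ℂ) ≠ 0 := by
    have := operatorConst_pos hα
    exact_mod_cast (by positivity : operatorConst α / t ^ α ≠ 0)
  rw [integrable_dataMeasure_iff]
  simp only [operatorIntegrand_eq]
  exact integrable_const_mul_iff (isUnit_iff_ne_zero.2 hc) _

theorem integral_mul_featureFun (g : ℝ → ℂ) (z : sector α) :
    ∫ τ, g τ * conj (featureFun α t z τ) ∂dataMeasure α t = sectorOperator α t g z := by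
  rw [integral_dataMeasure]
  simp only [operatorIntegrand_eq]
  rw [integral_const_mul, sectorOperator, operatorConst, div_div]

/-- The feature map of the operator `L_t^α`. -/
noncomputable def featureMap (hα : 0 < α) (hα2 : α ≤ 2) (ht : 0 < t) (z : sector α) :
    Lp ℂ 2 (dataMeasure α t) :=
  (memLp_featureFun hα hα2 ht z).toLp

theorem integrable_featureMap (hα : 0 < α) (hα2 : α ≤ 2) (ht : 0 < t)
    (g : Lp ℂ 2 (dataMeasure α t)) (z : sector α) :
    Integrable (fun τ => g τ * conj (featureFun α t z τ)) (dataMeasure α t) := by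
  refine (L2.integrable_inner (𝕜 := ℂ) (featureMap hα hα2 ht z) g).congr ?_
  filter_upwards [(memLp_featureFun hα hα2 ht z).coeFn_toLp] with τ hτ
  rw [featureMap, hτ, RCLike.inner_apply]

theorem inner_featureMap (hα : 0 < α) (hα2 : α ≤ 2) (ht : 0 < t)
    (g : Lp ℂ 2 (dataMeasure α t)) (z : sector α) :
    ⟪featureMap hα hα2 ht z, g⟫_ℂ = sectorOperator α t g z := by
  rw [← integral_mul_featureFun, L2.inner_def]
  refine integral_congr_ae ?_
  filter_upwards [(memLp_featureFun hα hα2 ht z).coeFn_toLp] with τ hτ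
  rw [featureMap, hτ, RCLike.inner_apply]

/-- The product of two kernels carries `τ ^ α / (t - τ) ^ (α + 2)` and one exponential in `w + conj
w₀`. That is the finite-interval Gamma integral with `p = α`. -/
theorem inner_featureMap_featureMap (hα : 0 < α) (hα2 : α ≤ 2) (ht : 0 < t) (z z₀ : sector α) :
    ⟪featureMap hα hα2 ht z, featureMap hα hα2 ht z₀⟫_ℂ = sectorKernel α t z₀ z := by
  set w : ℂ := (z : ℂ) ^ ((2 / α : ℝ) : ℂ) with hw
  set w₀ : ℂ := (z₀ : ℂ) ^ ((2 / α : ℝ) : ℂ) with hw₀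
  have hre : 0 < (w + conj w₀).re := by
    have h1 : 0 < w.re := rePow_pos hα z.2
    have h2 : 0 < w₀.re := rePow_pos hα z₀.2
    rw [Complex.add_re, Complex.conj_re]
    positivity
  have hβ : 0 < (((α ^ 2 / 4 : ℝ) : ℂ) * (w + conj w₀)).re := by
    rw [Complex.re_ofReal_mul]
    positivity
  have h1 : ⟪featureMap hα hα2 ht z, featureMap hα hα2 ht z₀⟫_ℂ =
      ∫ τ, featureFun α t z₀ τ * conj (featureFun α t z τ) ∂dataMeasure α t := by
    rw [L2.inner_def]
    refine integral_congr_ae ?_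
    filter_upwards [(memLp_featureFun hα hα2 ht z).coeFn_toLp,
      (memLp_featureFun hα hα2 ht z₀).coeFn_toLp] with τ hτ hτ₀
    rw [featureMap, featureMap, hτ, hτ₀, RCLike.inner_apply]
  have h2 : ∀ τ ∈ Set.Ioo 0 t, (τ ^ α / t ^ α) •
      (featureFun α t z₀ τ * conj (featureFun α t z τ)) =
      (((operatorConst α ^ 2 / t ^ α : ℝ) : ℂ) * (z * conj (z₀ : ℂ))) *
      (((τ ^ α / (t - τ) ^ (α + 2) : ℝ) : ℂ) *
        Complex.exp (-(((α ^ 2 / 4 : ℝ) : ℂ) * (w + conj w₀)) / ((t : ℂ) - τ))) := by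
    intro τ hτ
    have hpos : 0 < t - τ := sub_pos.2 hτ.2
    have h3 : (t - τ) ^ (α + 2) = (t - τ) ^ (α / 2 + 1) * (t - τ) ^ (α / 2 + 1) := by
      rw [← Real.rpow_add hpos]
      ring_nf
    have h4 : Complex.exp (-(((α ^ 2 / 4 : ℝ) : ℂ) * (w + conj w₀)) / ((t : ℂ) - τ)) =
        Complex.exp (-((α : ℂ) ^ 2 * w) / (4 * ((t : ℂ) - (τ : ℂ)))) *
        Complex.exp (-((α : ℂ) ^ 2 * conj w₀) / (4 * ((t : ℂ) - (τ : ℂ)))) := by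
      have : (t : ℂ) - τ ≠ 0 := by
        rw [← Complex.ofReal_sub]
        exact_mod_cast hpos.ne'
      rw [← Complex.exp_add]
      congr 1
      push_cast
      field_simp
      ring
    have h5 : conj (Complex.exp (-((α : ℂ) ^ 2 * w₀) / (4 * ((t : ℂ) - (τ : ℂ))))) =
        Complex.exp (-((α : ℂ) ^ 2 * conj w₀) / (4 * ((t : ℂ) - (τ : ℂ)))) := by
      rw [← Complex.exp_conj]
      simp [Complex.conj_ofNat]
    rw [featureFun, featureFun, Complex.conj_conj, operatorKernel, operatorKernel, ← hw, ← hw₀,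
      map_mul, map_mul, map_div₀, Complex.conj_ofReal, Complex.conj_ofReal, h5, h4, h3,
      Complex.real_smul]
    push_cast
    ring
  rw [h1, integral_dataMeasure, setIntegral_congr_fun measurableSet_Ioo h2, integral_const_mul,
    integral_Ioo_rpow_mul_cexp_div (by linarith) ht hβ, sectorKernel, ← hw, ← hw₀]
  have hc : (((α ^ 2 / 4 : ℝ) : ℂ) * (w + conj w₀)) ^ ((-(α + 1) : ℝ) : ℂ) =
      (((α ^ 2 / 4) ^ (-(α + 1)) : ℝ) : ℂ) * (w + conj w₀) ^ ((-(α + 1) : ℝ) : ℂ) := by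
    have hne : w + conj w₀ ≠ 0 := fun h => by simp [h] at hre
    have h6 := ofReal_mul_inv_cpow (r := α ^ 2 / 4) (by positivity) (u := (w + conj w₀)⁻¹)
      (by rw [Complex.inv_re]; exact div_pos hre (Complex.normSq_pos.2 hne))
      ((-(α + 1) : ℝ) : ℂ)
    rw [inv_inv] at h6
    rw [h6, Complex.ofReal_cpow (by positivity), Complex.inv_cpow, inv_inv]
    exact (Complex.mem_slitPlane_iff_arg.1 (Or.inl hre)).1
  have hexp : -(((α ^ 2 / 4 : ℝ) : ℂ) * (w + conj w₀)) / (t : ℂ) =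
      -(((α ^ 2 / (4 * t) : ℝ) : ℂ) * (w + conj w₀)) := by
    have : (t : ℂ) ≠ 0 := by exact_mod_cast ht.ne'
    push_cast
    field_simp
  -- The powers of `α / 2` combine as `2 α - 2 (α + 1) = -2`.
  have hconst : operatorConst α ^ 2 / t ^ α * t ^ α * Real.Gamma (α + 1) *
      (α ^ 2 / 4) ^ (-(α + 1)) =
      Real.Gamma (α + 1) / Real.Gamma (α / 2) ^ 2 * (α / 2) ^ (-2 : ℝ) := by
    have h7 : α ^ 2 / 4 = (α / 2) ^ (2 : ℝ) := by
      norm_num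
      ring
    have h8 : (α / 2) ^ (2 * -(α + 1)) = ((α / 2) ^ α * (α / 2) ^ α)⁻¹ * (α / 2) ^ (-2 : ℝ) := by
      rw [← Real.rpow_add (by positivity), ← Real.rpow_neg (by positivity),
        ← Real.rpow_add (by positivity)]
      ring_nf
    have h9 : (α / 2) ^ α ≠ 0 := by positivity
    have h10 : t ^ α ≠ 0 := by positivity
    have h11 := (Real.Gamma_pos_of_pos (half_pos hα)).ne'
    rw [h7, ← Real.rpow_mul (by positivity), h8, operatorConst]
    field_simp
  rw [hc, hexp, ← hconst]
  push_cast
  ring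

/-- At `z = (1 + i x) ^ (α/2)` the exponential splits into the one for `z = 1` and the character
`exp (i x ψ(τ))`, with `ψ(τ) = -(α²/4) / (t - τ)`. A vector orthogonal to all features thus has,
after multiplication by the nowhere zero kernel at `1`, a vanishing Fourier transform. -/
theorem span_featureMap_dense (hα : 0 < α) (hα2 : α ≤ 2) (ht : 0 < t) :
    Dense (Submodule.span ℂ (Set.range (featureMap hα hα2 ht)) :
      Set (Lp ℂ 2 (dataMeasure α t))) := by
  rw [Submodule.dense_iff_topologicalClosure_eq_top, Submodule.topologicalClosure_eq_top_iff,
    Submodule.eq_bot_iff]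
  intro g hg
  have h0 : ∀ z : sector α, ∫ τ, g τ * conj (featureFun α t z τ) ∂dataMeasure α t = 0 := by
    intro z
    rw [integral_mul_featureFun, ← inner_featureMap hα hα2 ht]
    exact (Submodule.mem_orthogonal _ _).1 hg _ (Submodule.subset_span ⟨z, rfl⟩)
  let φ : ℝ → ℂ := fun w => ((1 + w * Complex.I : ℂ)) ^ ((α / 2 : ℝ) : ℂ)
  have hre : ∀ w : ℝ, 0 < (1 + w * Complex.I : ℂ).re := fun w => by simp
  have hφ : ∀ w, φ w ∈ sector α := fun w => (bijOn_cpow_half hα hα2).mapsTo (hre w)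
  have hone : (1 : ℂ) ∈ sector α := by
    simpa [φ] using hφ 0
  have hG := integrable_featureMap hα hα2 ht g ⟨1, hone⟩
  -- With `0⁻¹ = 0` this map is injective on the whole line, including at `τ = t`, so no restriction
  -- to the interval is needed.
  have hψ : MeasurableEmbedding fun τ : ℝ => -(α ^ 2 / 4) * (t - τ)⁻¹ := by
    refine Measurable.measurableEmbedding (by fun_prop) fun τ τ' h => ?_
    exact sub_right_injective (inv_injective
      (mul_left_cancel₀ (neg_ne_zero.2 (by positivity : α ^ 2 / 4 ≠ 0)) h))
  have hz := ae_eq_zero_of_integral_mul_cexp_eq_zero hG hψ fun x => ?_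
  · rw [Lp.eq_zero_iff_ae_eq_zero]
    filter_upwards [hz, ae_dataMeasure_mem α t] with τ hτ hmem
    have hpos : 0 < t - τ := sub_pos.2 hmem.2
    refine (mul_eq_zero.1 hτ).resolve_right ?_
    have h2 : (operatorConst α : ℂ) ≠ 0 := by exact_mod_cast (operatorConst_pos hα).ne'
    have h3 : (((t - τ) ^ (α / 2 + 1) : ℝ) : ℂ) ≠ 0 := by
      exact_mod_cast (by positivity : (t - τ) ^ (α / 2 + 1) ≠ 0)
    rw [featureFun, Complex.conj_conj, operatorKernel]
    exact mul_ne_zero h2 (mul_ne_zero (div_ne_zero one_ne_zero h3) (Complex.exp_ne_zero _))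
  · have hφ0 : φ x ≠ 0 := (hφ x).1
    refine mul_left_cancel₀ hφ0 ?_
    rw [mul_zero, ← h0 ⟨φ x, hφ x⟩, ← integral_const_mul]
    refine integral_congr_ae (.of_forall fun τ => ?_)
    have h4 : φ x ^ ((2 / α : ℝ) : ℂ) = 1 + x * Complex.I := cpow_half_cpow_two_div hα hα2 (hre x)
    simp only [featureFun, Complex.conj_conj, operatorKernel, h4, Complex.one_cpow]
    have h5 : Complex.exp (-((α : ℂ) ^ 2 * (1 + x * Complex.I)) / (4 * ((t : ℂ) - τ))) =
        Complex.exp (-((α : ℂ) ^ 2 * 1) / (4 * ((t : ℂ) - τ))) *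
        Complex.exp (x * ((-(α ^ 2 / 4) * (t - τ)⁻¹ : ℝ) : ℂ) * Complex.I) := by
      rw [← Complex.exp_add]
      congr 1
      push_cast
      rw [div_eq_mul_inv, div_eq_mul_inv, mul_inv]
      ring
    rw [h5]
    ring

end OperatorKernel

/-! ### The image space as a holomorphic `L²` space -/

section ImageSpace

variable {α t : ℝ}

theorem imageMultiplier_ne_zero (z : sector α) : imageMultiplier α t z ≠ 0 := by
  refine mul_ne_zero ?_ (Complex.exp_ne_zero _)
  rw [Complex.cpow_ne_zero_iff]
  exact Or.inl z.2.1

theorem inv_imageMultiplier (z : sector α) : (imageMultiplier α t z)⁻¹ =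
    (z : ℂ) ^ (((1 - α) * (α + 2) / (2 * α) : ℝ) : ℂ) *
      Complex.exp (((α : ℂ) ^ 2 / (4 * (t : ℂ))) * (z : ℂ) ^ ((2 / α : ℝ) : ℂ)) := by
  rw [imageMultiplier, mul_inv, ← Complex.exp_neg, ← Complex.cpow_neg, ← Complex.ofReal_neg]
  ring_nf

theorem differentiableOn_imageMultiplier (hα2 : α ≤ 2) :
    DifferentiableOn ℂ (fun z : ℂ => z ^ (((α - 1) * (α + 2) / (2 * α) : ℝ) : ℂ) *
      Complex.exp (-((α : ℂ) ^ 2 / (4 * (t : ℂ))) * z ^ ((2 / α : ℝ) : ℂ))) (sector α) := by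
  have h1 : ∀ p : ℂ, DifferentiableOn ℂ (fun z : ℂ => z ^ p) (sector α) := fun p z hz =>
    (differentiableAt_id.cpow (differentiableAt_const _)
      (mem_slitPlane_of_mem_sector hα2 hz)).differentiableWithinAt
  exact (h1 _).mul ((h1 _).const_mul _).cexp

theorem HolomorphicOnSector.mul {f g : sector α → ℂ} (hf : HolomorphicOnSector α f)
    (hg : HolomorphicOnSector α g) : HolomorphicOnSector α (fun z => f z * g z) := by
  obtain ⟨h, hh, hfh⟩ := hf
  obtain ⟨k, hk, hgk⟩ := hg
  exact ⟨fun z => h z * k z, hh.mul hk, fun z => by simp only [hfh, hgk]⟩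

theorem holomorphicOnSector_imageMultiplier (hα2 : α ≤ 2) :
    HolomorphicOnSector α (imageMultiplier α t) :=
  ⟨_, differentiableOn_imageMultiplier hα2, fun _ => rfl⟩

theorem holomorphicOnSector_inv_imageMultiplier (hα2 : α ≤ 2) :
    HolomorphicOnSector α fun z => (imageMultiplier α t z)⁻¹ :=
  ⟨_, (differentiableOn_imageMultiplier (t := t) hα2).inv
    fun z hz => imageMultiplier_ne_zero (t := t) ⟨z, hz⟩, fun _ => rfl⟩

/-- The exponentials cancel and the powers of `‖z‖` add up to `(α - 2)(α - 1)/α`. Multiplication by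
the multiplier therefore carries the Bergman space onto the holomorphic part of `L²(sectorMeasure)`.
-/
theorem norm_sq_imageMultiplier_mul_sectorDensity (hα : 0 < α) (z : sector α) :
    ‖imageMultiplier α t z‖ ^ 2 * sectorDensity α t z =
      (Real.pi⁻¹ * 2 ^ (α - 1) * ProbabilityTheory.beta (α / 2) (α / 2)) * bergmanWeight α z := by
  have hz : 0 < ‖(z : ℂ)‖ := norm_pos_iff.2 z.2.1
  have h1 : (‖(z : ℂ)‖ ^ ((α - 1) * (α + 2) / (2 * α))) ^ 2 * ‖(z : ℂ)‖ ^ (4 * (1 - α) / α) =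
      ‖(z : ℂ)‖ ^ ((α - 2) * (α - 1) / α) := by
    rw [← Real.rpow_natCast, ← Real.rpow_mul hz.le, ← Real.rpow_add hz]
    congr 1
    push_cast
    field_simp
    ring
  have h2 : -((α : ℂ) ^ 2 / (4 * (t : ℂ))) * (z : ℂ) ^ ((2 / α : ℝ) : ℂ) =
      ((-(α ^ 2 / (4 * t)) : ℝ) : ℂ) * (z : ℂ) ^ ((2 / α : ℝ) : ℂ) := by
    push_cast
    ring
  have h3 : Real.exp (-(α ^ 2 / (4 * t)) * rePow α z) ^ 2 *
      Real.exp (α ^ 2 / (2 * t) * rePow α z) = 1 := by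
    rw [← Real.exp_nat_mul, ← Real.exp_add, Real.exp_eq_one_iff]
    push_cast
    by_cases ht : t = 0
    · simp [ht]
    · field_simp
      ring
  rw [imageMultiplier, norm_mul, Complex.norm_cpow_real, h2, Complex.norm_exp,
    Complex.re_ofReal_mul, ← rePow, bergmanWeight, ← h1, sectorDensity]
  linear_combination (Real.pi⁻¹ * 2 ^ (α - 1) * ProbabilityTheory.beta (α / 2) (α / 2) *
    ((‖(z : ℂ)‖ ^ ((α - 1) * (α + 2) / (2 * α))) ^ 2 * ‖(z : ℂ)‖ ^ (4 * (1 - α) / α)) *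
    rePow α z ^ (α - 1)) * h3

theorem sectorDensity_mul_norm_sq (hα : 0 < α) (f : sector α → ℂ) (z : sector α) :
    sectorDensity α t z • ‖imageMultiplier α t z * f z‖ ^ 2 =
      (Real.pi⁻¹ * 2 ^ (α - 1) * ProbabilityTheory.beta (α / 2) (α / 2)) *
        (‖f z‖ ^ 2 * bergmanWeight α z) := by
  rw [norm_mul, mul_pow, smul_eq_mul, ← mul_assoc, mul_comm (sectorDensity α t z),
    norm_sq_imageMultiplier_mul_sectorDensity hα]
  ring

/-- The image space is the space of the square integrable holomorphic functions. -/
theorem mem_imageSpace_iff (hα : 0 < α) (hα2 : α ≤ 2) (F : sector α → ℂ) :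
    F ∈ imageSpace α t ↔ HolomorphicOnSector α F ∧ MemLp F 2 (sectorMeasure α t) := by
  have hc : IsUnit (Real.pi⁻¹ * 2 ^ (α - 1) * ProbabilityTheory.beta (α / 2) (α / 2)) := by
    have := beta_half_pos hα
    exact isUnit_iff_ne_zero.2 (by positivity)
  have key : ∀ f : sector α → ℂ,
      Integrable (fun z => ‖imageMultiplier α t z * f z‖ ^ 2) (sectorMeasure α t) ↔
        Integrable (fun z : sector α => ‖f z‖ ^ 2 * bergmanWeight α z) (areaMeasure α) := by
    intro f
    rw [integrable_sectorMeasure_iff_density hα]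
    simp only [sectorDensity_mul_norm_sq hα]
    exact integrable_const_mul_iff hc _
  constructor
  · rintro ⟨f, ⟨hf, hfi⟩, rfl⟩
    have hhol : HolomorphicOnSector α fun z => imageMultiplier α t z * f z :=
      (holomorphicOnSector_imageMultiplier hα2).mul hf
    refine ⟨hhol, ?_⟩
    exact (memLp_two_iff_integrable_sq_norm hhol.continuous.aestronglyMeasurable).2 ((key f).2 hfi)
  · rintro ⟨hF, hFi⟩
    have hfF : ∀ z, imageMultiplier α t z * ((imageMultiplier α t z)⁻¹ * F z) = F z := fun z =>
      mul_inv_cancel_left₀ (imageMultiplier_ne_zero z) _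
    refine ⟨fun z => (imageMultiplier α t z)⁻¹ * F z,
      ⟨(holomorphicOnSector_inv_imageMultiplier hα2).mul hF, ?_⟩, funext hfF⟩
    refine (key fun z => (imageMultiplier α t z)⁻¹ * F z).1 ?_
    simp only [hfF]
    exact (memLp_two_iff_integrable_sq_norm hF.continuous.aestronglyMeasurable).1 hFi

/-- The prefactor of the image norm, squared, times that of the Bergman inner product is the
constant in `sectorMeasure`; this upgrades proportional norms to equal ones. -/
theorem imageNorm_const (hα : 0 < α) :
    (ProbabilityTheory.beta (α / 2) (α / 2) ^ (1 / 2 : ℝ) /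
      ((α / 2) ^ ((α - 1) / 2) * Real.pi ^ ((α + 1) / 4))) ^ 2 *
      (α * Real.pi ^ (1 / 2 : ℝ)) ^ (α - 1) =
      Real.pi⁻¹ * 2 ^ (α - 1) * ProbabilityTheory.beta (α / 2) (α / 2) := by
  have hB := beta_half_pos hα
  have hpi := Real.pi_pos
  have h1 : (ProbabilityTheory.beta (α / 2) (α / 2) ^ (1 / 2 : ℝ)) ^ 2 =
      ProbabilityTheory.beta (α / 2) (α / 2) := by
    rw [← Real.sqrt_eq_rpow, Real.sq_sqrt hB.le]
  have h2 : ((α / 2) ^ ((α - 1) / 2)) ^ 2 = α ^ (α - 1) / 2 ^ (α - 1) := by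
    rw [← Real.rpow_natCast, ← Real.rpow_mul (by positivity), ← Real.div_rpow hα.le two_pos.le]
    congr 1
    push_cast
    ring
  have h3 : (Real.pi ^ ((α + 1) / 4)) ^ 2 = (Real.pi ^ (1 / 2 : ℝ)) ^ (α - 1) * Real.pi := by
    rw [← Real.rpow_natCast, ← Real.rpow_mul hpi.le, ← Real.rpow_mul hpi.le,
      ← Real.rpow_add_one hpi.ne']
    congr 1
    push_cast
    ring
  rw [div_pow, mul_pow, h1, h2, h3, Real.mul_rpow hα.le (by positivity)]
  have h4 : α ^ (α - 1) ≠ 0 := by positivity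
  have h5 : (2 : ℝ) ^ (α - 1) ≠ 0 := by positivity
  have h6 : (Real.pi ^ (1 / 2 : ℝ)) ^ (α - 1) ≠ 0 := by positivity
  field_simp

theorem imageNorm_eq_sqrt_integral (hα : 0 < α) (F : sector α → ℂ) :
    imageNorm α t F = Real.sqrt (∫ z, ‖F z‖ ^ 2 ∂sectorMeasure α t) := by
  have hB := beta_half_pos hα
  have hfF : ∀ z, imageMultiplier α t z * ((imageMultiplier α t z)⁻¹ * F z) = F z := fun z =>
    mul_inv_cancel_left₀ (imageMultiplier_ne_zero z) _
  have h1 : ∫ z, ‖F z‖ ^ 2 ∂sectorMeasure α t =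
      (Real.pi⁻¹ * 2 ^ (α - 1) * ProbabilityTheory.beta (α / 2) (α / 2)) *
        ∫ z : sector α, ‖(imageMultiplier α t z)⁻¹ * F z‖ ^ 2 * bergmanWeight α z
          ∂areaMeasure α := by
    rw [integral_sectorMeasure_density hα, ← integral_const_mul]
    refine integral_congr_ae (.of_forall fun z => ?_)
    have h2 := sectorDensity_mul_norm_sq (t := t) hα (fun z => (imageMultiplier α t z)⁻¹ * F z) z
    rwa [hfF] at h2
  have h3 : (bergmanInner α (fun z => (imageMultiplier α t z)⁻¹ * F z)
      (fun z => (imageMultiplier α t z)⁻¹ * F z)).re = (α * Real.pi ^ (1 / 2 : ℝ)) ^ (α - 1) *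
        ∫ z : sector α, ‖(imageMultiplier α t z)⁻¹ * F z‖ ^ 2 * bergmanWeight α z
          ∂areaMeasure α := by
    rw [bergmanInner, Complex.re_ofReal_mul]
    congr 1
    rw [← Complex.ofReal_re (∫ z : sector α, _ ∂areaMeasure α), ← integral_complex_ofReal]
    congr 1
    refine integral_congr_ae (.of_forall fun z => ?_)
    simp only [Complex.mul_conj, Complex.normSq_eq_norm_sq, Complex.ofReal_mul]
  have hc : 0 ≤ ProbabilityTheory.beta (α / 2) (α / 2) ^ (1 / 2 : ℝ) /
      ((α / 2) ^ ((α - 1) / 2) * Real.pi ^ ((α + 1) / 4)) := by positivity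
  simp only [imageNorm, ← inv_imageMultiplier]
  rw [bergmanNorm, h3, h1, ← imageNorm_const hα, mul_assoc (_ ^ 2), Real.sqrt_mul (sq_nonneg _),
    Real.sqrt_sq hc]

end ImageSpace

/-! ### Norms and truncations in `L²` -/

theorem norm_toLp_two_sq {X : Type*} [MeasurableSpace X] {μ : Measure X} {f : X → ℂ}
    (hf : MemLp f 2 μ) : ‖hf.toLp‖ ^ 2 = ∫ x, ‖f x‖ ^ 2 ∂μ := by
  have h1 : ⟪hf.toLp, hf.toLp⟫_ℂ = ((∫ x, ‖f x‖ ^ 2 ∂μ : ℝ) : ℂ) := by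
    rw [L2.inner_def, ← integral_complex_ofReal]
    refine integral_congr_ae ?_
    filter_upwards [hf.coeFn_toLp] with x hx
    rw [hx, RCLike.inner_apply, Complex.mul_conj, Complex.normSq_eq_norm_sq]
  rw [← inner_self_eq_norm_sq (𝕜 := ℂ), h1]
  exact Complex.ofReal_re _

/-- The squared error is the integral of `‖f‖²` over the complements, which decrease to the empty
set. -/
theorem tendsto_toLp_indicator {X : Type*} [MeasurableSpace X] {μ : Measure X} {f : X → ℂ}
    (hf : MemLp f 2 μ) {s : ℕ → Set X} (hs : ∀ n, MeasurableSet (s n)) (hmono : Monotone s)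
    (huniv : ⋃ n, s n = Set.univ) :
    Tendsto (fun n => (hf.indicator (hs n)).toLp ((s n).indicator f)) atTop (𝓝 hf.toLp) := by
  rw [tendsto_iff_norm_sub_tendsto_zero]
  have h1 : ∀ n, ‖(hf.indicator (hs n)).toLp ((s n).indicator f) - hf.toLp‖ ^ 2 =
      ∫ x in (s n)ᶜ, ‖f x‖ ^ 2 ∂μ := by
    intro n
    rw [← MemLp.toLp_sub, norm_toLp_two_sq, ← integral_indicator (hs n).compl]
    refine integral_congr_ae (.of_forall fun x => ?_)
    by_cases hx : x ∈ s n <;> simp [hx]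
  have h2 : Tendsto (fun n => ∫ x in (s n)ᶜ, ‖f x‖ ^ 2 ∂μ) atTop (𝓝 0) := by
    have hint := (memLp_two_iff_integrable_sq_norm hf.1).1 hf
    have := tendsto_setIntegral_of_antitone (μ := μ) (f := fun x => ‖f x‖ ^ 2)
      (s := fun n => (s n)ᶜ) (fun n => (hs n).compl)
      (fun m n hmn => Set.compl_subset_compl.2 (hmono hmn)) ⟨0, hint.integrableOn⟩
    rwa [← Set.compl_iUnion, huniv, Set.compl_univ, setIntegral_empty] at this
  have h3 := h2.sqrt
  simp only [← h1, Real.sqrt_sq (norm_nonneg _), Real.sqrt_zero] at h3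
  exact h3

/-! ### The isometry into the image space -/

section Isometry

variable {α t : ℝ}

theorem memLp_sectorKernel (hα : 0 < α) (hα2 : α ≤ 2) (z₀ : sector α) :
    MemLp (fun z : sector α => sectorKernel α t z₀ z) 2 (sectorMeasure α t) := by
  have hhol : HolomorphicOnSector α fun z : sector α => sectorKernel α t z₀ z :=
    ⟨_, differentiableOn_sectorKernel hα hα2 z₀.2, fun _ => rfl⟩
  exact (memLp_two_iff_integrable_sq_norm hhol.continuous.aestronglyMeasurable).2
    (integrable_norm_sq_sectorKernel hα hα2 z₀.2)

theorem integral_mul_conj_inner_featureMap (hα : 0 < α) (hα2 : α ≤ 2) (ht : 0 < t)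
    {F : sector α → ℂ} (hF : HolomorphicOnSector α F) (hF2 : MemLp F 2 (sectorMeasure α t))
    (z₀ : sector α) :
    ∫ z, F z * conj ⟪featureMap hα hα2 ht z, featureMap hα hα2 ht z₀⟫_ℂ ∂sectorMeasure α t =
      F z₀ := by
  obtain ⟨h, hh, hFh⟩ := hF
  have hint := (memLp_two_iff_integrable_sq_norm hF2.1).1 hF2
  simp only [hFh] at hint ⊢
  simp only [inner_featureMap_featureMap]
  exact sector_reproducing hα hα2 hh hint z₀.2

theorem exists_linearIsometry_featureMap (hα : 0 < α) (hα2 : α ≤ 2) (ht : 0 < t) :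
    ∃ U : Lp ℂ 2 (dataMeasure α t) →ₗᵢ[ℂ] Lp ℂ 2 (sectorMeasure α t),
      ∀ g, U g =ᵐ[sectorMeasure α t] fun z => ⟪featureMap hα hα2 ht z, g⟫_ℂ := by
  have hmem : ∀ z₀, MemLp (fun z => ⟪featureMap hα hα2 ht z, featureMap hα hα2 ht z₀⟫_ℂ) 2
      (sectorMeasure α t) := fun z₀ => by
    simp only [inner_featureMap_featureMap]
    exact memLp_sectorKernel hα hα2 z₀
  refine exists_linearIsometry_of_reproducing _ hmem (fun z₀ z₁ => ?_)
    (span_featureMap_dense hα hα2 ht)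
  refine integral_mul_conj_inner_featureMap hα hα2 ht ?_ (hmem z₀) z₁
  simp only [inner_featureMap_featureMap]
  exact ⟨_, differentiableOn_sectorKernel hα hα2 z₀.2, fun _ => rfl⟩

theorem exists_norm_featureMap_le (hα : 0 < α) (hα2 : α ≤ 2) (ht : 0 < t) {E : Set (sector α)}
    (hE : IsCompact E) : ∃ M, ∀ z ∈ E, ‖featureMap hα hα2 ht z‖ ≤ M := by
  have := isFiniteMeasure_dataMeasure hα ht
  obtain ⟨M, hM⟩ := exists_norm_operatorKernel_le (t := t) hα hα2 hE
  rcases E.eq_empty_or_nonempty with rfl | ⟨z₁, hz₁⟩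
  · simp
  have hM0 : 0 ≤ M := (norm_nonneg _).trans (hM z₁ hz₁ (t / 2) ⟨by positivity, by linarith⟩)
  have hc := (operatorConst_pos hα).le
  refine ⟨_, fun z hz => Lp.norm_le_of_ae_bound (C := operatorConst α * M) (by positivity) ?_⟩
  filter_upwards [(memLp_featureFun hα hα2 ht z).coeFn_toLp, ae_dataMeasure_mem α t] with τ h1 h2
  rw [featureMap, h1, featureFun, RCLike.norm_conj, norm_mul, Complex.norm_real,
    Real.norm_of_nonneg hc]
  exact mul_le_mul_of_nonneg_left (hM z hz τ h2) hc

theorem holomorphicOnSector_iff_extend {f : sector α → ℂ} : HolomorphicOnSector α f ↔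
    DifferentiableOn ℂ (Function.extend Subtype.val f 0) (sector α) := by
  constructor
  · rintro ⟨h, hh, hf⟩
    refine hh.congr fun z hz => ?_
    exact (Subtype.val_injective.extend_apply f 0 ⟨z, hz⟩).trans (hf ⟨z, hz⟩)
  · exact fun h => ⟨_, h, fun z => (Subtype.val_injective.extend_apply f 0 z).symm⟩

/-- For `g` in the span the transform is a combination of the holomorphic kernel functions. In
general, Cauchy–Schwarz and the bound of `‖k z‖` on compact sets make it a locally uniform limit of
such functions. -/
theorem holomorphicOnSector_inner_featureMap (hα : 0 < α) (hα2 : α ≤ 2) (ht : 0 < t)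
    (g : Lp ℂ 2 (dataMeasure α t)) :
    HolomorphicOnSector α fun z => ⟪featureMap hα hα2 ht z, g⟫_ℂ := by
  have hspan : ∀ g ∈ Submodule.span ℂ (Set.range (featureMap hα hα2 ht)),
      HolomorphicOnSector α fun z => ⟪featureMap hα hα2 ht z, g⟫_ℂ := by
    intro g hg
    induction hg using Submodule.span_induction with
    | mem x hx =>
      obtain ⟨z₀, rfl⟩ := hx
      simp only [inner_featureMap_featureMap]
      exact ⟨_, differentiableOn_sectorKernel hα hα2 z₀.2, fun _ => rfl⟩
    | zero => exact ⟨0, differentiableOn_const 0, fun z => by simp⟩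
    | add x y _ _ hx hy =>
      obtain ⟨h, hh, hf⟩ := hx
      obtain ⟨k, hk, hg⟩ := hy
      exact ⟨h + k, hh.add hk, fun z =>
        (inner_add_right _ _ _).trans (congrArg₂ (· + ·) (hf z) (hg z))⟩
    | smul c x _ hx =>
      obtain ⟨h, hh, hf⟩ := hx
      exact ⟨c • h, hh.const_smul c, fun z =>
        (inner_smul_right _ _ _).trans (congrArg (c * ·) (hf z))⟩
  obtain ⟨u, hu, hug⟩ := mem_closure_iff_seq_limit.1 (span_featureMap_dense hα hα2 ht g)
  rw [holomorphicOnSector_iff_extend]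
  have hopen := isOpen_sector hα2
  refine TendstoLocallyUniformlyOn.differentiableOn (φ := atTop)
    (F := fun n => Function.extend Subtype.val (fun z => ⟪featureMap hα hα2 ht z, u n⟫_ℂ) 0)
    ?_ (.of_forall fun n => holomorphicOnSector_iff_extend.1 (hspan _ (hu n))) hopen
  rw [tendstoLocallyUniformlyOn_iff_forall_isCompact hopen]
  intro K hKs hK
  have hK' : IsCompact (Subtype.val ⁻¹' K : Set (sector α)) := by
    rw [Subtype.isCompact_iff, Subtype.image_preimage_coe, Set.inter_eq_right.2 hKs]
    exact hK
  obtain ⟨M, hM⟩ := exists_norm_featureMap_le hα hα2 ht hK'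
  have h0 : Tendsto (fun n => M * ‖u n - g‖) atTop (𝓝 0) := by
    simpa using (tendsto_iff_norm_sub_tendsto_zero.1 hug).const_mul M
  rw [Metric.tendstoUniformlyOn_iff]
  intro ε hε
  filter_upwards [h0.eventually (gt_mem_nhds hε)] with n hn z hz
  have h1 : ∀ f : sector α → ℂ, Function.extend Subtype.val f 0 z = f ⟨z, hKs hz⟩ := fun f =>
    Subtype.val_injective.extend_apply f 0 ⟨z, hKs hz⟩
  rw [h1, h1, dist_comm, dist_eq_norm, ← inner_sub_right]
  refine (norm_inner_le_norm _ _).trans_lt (lt_of_le_of_lt ?_ hn)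
  exact mul_le_mul_of_nonneg_right (hM ⟨z, hKs hz⟩ hz) (norm_nonneg _)

theorem sectorOperator_mem_imageSpace (hα : 0 < α) (hα2 : α ≤ 2) (ht : 0 < t)
    (g : Lp ℂ 2 (dataMeasure α t)) : sectorOperator α t g ∈ imageSpace α t := by
  obtain ⟨U, hU⟩ := exists_linearIsometry_featureMap hα hα2 ht
  have h1 : sectorOperator α t g = fun z => ⟪featureMap hα hα2 ht z, g⟫_ℂ :=
    funext fun z => (inner_featureMap hα hα2 ht g z).symm
  rw [h1, mem_imageSpace_iff hα hα2]
  exact ⟨holomorphicOnSector_inner_featureMap hα hα2 ht g,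
    (memLp_congr_ae (hU g)).1 (Lp.memLp (U g))⟩

theorem imageNorm_sectorOperator (hα : 0 < α) (hα2 : α ≤ 2) (ht : 0 < t)
    (g : Lp ℂ 2 (dataMeasure α t)) : imageNorm α t (sectorOperator α t g) = ‖g‖ := by
  obtain ⟨U, hU⟩ := exists_linearIsometry_featureMap hα hα2 ht
  have h1 := norm_toLp_two_sq (Lp.memLp (U g))
  rw [Lp.toLp_coeFn, U.norm_map] at h1
  rw [imageNorm_eq_sqrt_integral hα, ← Real.sqrt_sq (norm_nonneg g), h1]
  congr 1
  refine integral_congr_ae ?_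
  filter_upwards [hU g] with z hz
  rw [hz, inner_featureMap]

end Isometry

/-! ### The truncated inverse and the adjoint -/

section Inversion

variable {α t : ℝ}

theorem continuous_sectorDensity (hα : 0 < α) (hα2 : α ≤ 2) :
    Continuous fun z : sector α => sectorDensity α t z := by
  have h1 := continuous_rePow_sector hα2
  have h2 : Continuous fun z : sector α => ‖(z : ℂ)‖ ^ (4 * (1 - α) / α) :=
    continuous_subtype_val.norm.rpow_const fun z => Or.inl (norm_ne_zero_iff.2 z.2.1)
  have h3 : Continuous fun z : sector α => rePow α z ^ (α - 1) :=
    h1.rpow_const fun z => Or.inl (rePow_pos hα z.2).ne'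
  unfold sectorDensity
  fun_prop

theorem sectorMeasure_lt_top_of_isCompact (hα : 0 < α) (hα2 : α ≤ 2) {E : Set (sector α)}
    (hE : IsCompact E) : sectorMeasure α t E < ⊤ := by
  obtain ⟨C, hC⟩ := hE.exists_bound_of_continuousOn
    (continuous_sectorDensity (t := t) hα hα2).continuousOn
  have harea : areaMeasure α E < ⊤ := by
    rw [areaMeasure, comap_subtype_coe_apply (isOpen_sector hα2).measurableSet]
    exact (hE.image continuous_subtype_val).measure_lt_top
  rw [sectorMeasure_eq, withDensity_apply _ hE.measurableSet]
  calc _ ≤ ∫⁻ z in E, ENNReal.ofReal C ∂areaMeasure α := by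
        refine setLIntegral_mono measurable_const fun z hz => ?_
        exact ENNReal.ofReal_le_ofReal ((le_abs_self _).trans (hC z hz))
    _ < ⊤ := by
        rw [setLIntegral_const]
        exact ENNReal.mul_lt_top ENNReal.ofReal_lt_top harea

/-- Conjugation commutes with the principal power off the negative axis, so the integrand of the
inverse formula is `F` times the feature function. -/
theorem inverseIntegrand_eq (hα : 0 < α) (hα2 : α ≤ 2) (F : sector α → ℂ) {τ : ℝ} (hτ : τ < t)
    (z : sector α) :
    (((α / 2) ^ α / (Real.Gamma (α / 2) * (t - τ) ^ (α / 2 + 1)) : ℝ) : ℂ) *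
      inverseIntegrand α t F τ z = F z * featureFun α t z τ := by
  have h1 : ((starRingEnd ℂ) (z : ℂ)) ^ ((2 / α : ℝ) : ℂ) =
      conj ((z : ℂ) ^ ((2 / α : ℝ) : ℂ)) := by
    rw [Complex.conj_cpow _ _ (arg_ne_pi_of_mem_sector hα2 z.2), Complex.conj_ofReal]
  have h2 : conj (Complex.exp (-((α : ℂ) ^ 2 * (z : ℂ) ^ ((2 / α : ℝ) : ℂ)) /
      (4 * ((t : ℂ) - (τ : ℂ))))) =
      Complex.exp (-((α : ℂ) ^ 2 * conj ((z : ℂ) ^ ((2 / α : ℝ) : ℂ))) /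
      (4 * ((t : ℂ) - (τ : ℂ)))) := by
    rw [← Complex.exp_conj]
    simp [Complex.conj_ofNat]
  rw [inverseIntegrand, h1, featureFun, operatorKernel, operatorConst, map_mul, map_mul, map_div₀,
    h2, Complex.conj_ofReal, Complex.conj_ofReal]
  have h3 : (((t - τ) ^ (α / 2 + 1) : ℝ) : ℂ) ≠ 0 := by
    have : 0 < t - τ := sub_pos.2 hτ
    exact_mod_cast (by positivity : (t - τ) ^ (α / 2 + 1) ≠ 0)
  have h4 : (Real.Gamma (α / 2) : ℂ) ≠ 0 := by
    exact_mod_cast (Real.Gamma_pos_of_pos (half_pos hα)).ne'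
  push_cast
  field_simp

theorem measurable_featureFun_uncurry (α t : ℝ) :
    Measurable fun p : sector α × ℝ => featureFun α t p.1 p.2 := by
  have h1 : Measurable fun p : sector α × ℝ => ((p.1 : ℂ), p.2) := by fun_prop
  exact Complex.continuous_conj.measurable.comp
    (((measurable_operatorKernel α t).comp h1).const_mul _)

theorem exists_norm_featureFun_le (hα : 0 < α) (hα2 : α ≤ 2) {E : Set (sector α)}
    (hE : IsCompact E) :
    ∃ M, ∀ z ∈ E, ∀ τ ∈ Set.Ioo 0 t, ‖featureFun α t z τ‖ ≤ M := by
  obtain ⟨M, hM⟩ := exists_norm_operatorKernel_le (t := t) hα hα2 hE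
  refine ⟨operatorConst α * M, fun z hz τ hτ => ?_⟩
  rw [featureFun, RCLike.norm_conj, norm_mul, Complex.norm_real,
    Real.norm_of_nonneg (operatorConst_pos hα).le]
  exact mul_le_mul_of_nonneg_left (hM z hz τ hτ) (operatorConst_pos hα).le

theorem integrableOn_mul_featureFun (hα : 0 < α) (hα2 : α ≤ 2) {E : Set (sector α)}
    (hE : IsCompact E) {F : sector α → ℂ} (hF : MemLp F 2 (sectorMeasure α t)) {τ : ℝ}
    (hτ : τ ∈ Set.Ioo 0 t) :
    IntegrableOn (fun z => F z * featureFun α t z τ) E (sectorMeasure α t) := by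
  have : IsFiniteMeasure ((sectorMeasure α t).restrict E) :=
    ⟨by simpa using sectorMeasure_lt_top_of_isCompact hα hα2 hE⟩
  obtain ⟨M, hM⟩ := exists_norm_featureFun_le (t := t) hα hα2 hE
  refine ((hF.restrict E).integrable one_le_two).mul_bdd (c := M) ?_ ?_
  · exact ((measurable_featureFun_uncurry α t).comp measurable_prodMk_right).aestronglyMeasurable
  · filter_upwards [ae_restrict_mem hE.measurableSet] with z hz using hM z hz τ hτ

theorem integrableOn_inverseIntegrand (hα : 0 < α) (hα2 : α ≤ 2) {E : Set (sector α)}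
    (hE : IsCompact E) {F : sector α → ℂ} (hF : MemLp F 2 (sectorMeasure α t)) {τ : ℝ}
    (hτ : τ ∈ Set.Ioo 0 t) :
    IntegrableOn (inverseIntegrand α t F τ) E (sectorMeasure α t) := by
  have hc : (((α / 2) ^ α / (Real.Gamma (α / 2) * (t - τ) ^ (α / 2 + 1)) : ℝ) : ℂ) ≠ 0 := by
    have h1 : 0 < t - τ := sub_pos.2 hτ.2
    have h2 := Real.Gamma_pos_of_pos (half_pos hα)
    exact_mod_cast (by positivity : (α / 2) ^ α / (Real.Gamma (α / 2) * (t - τ) ^ (α / 2 + 1)) ≠ 0)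
  have h3 := integrableOn_mul_featureFun hα hα2 hE hF hτ
  simp only [← inverseIntegrand_eq hα hα2 F hτ.2] at h3
  exact (integrable_const_mul_iff (isUnit_iff_ne_zero.2 hc) _).1 h3

theorem truncatedInverse_eq (hα : 0 < α) (hα2 : α ≤ 2) (F : sector α → ℂ) (E : Set (sector α))
    {τ : ℝ} (hτ : τ < t) :
    truncatedInverse α t F E τ = ∫ z in E, F z * featureFun α t z τ ∂sectorMeasure α t := by
  rw [truncatedInverse, ← integral_const_mul]
  simp only [inverseIntegrand_eq hα hα2 F hτ]

theorem memLp_truncatedInverse (hα : 0 < α) (hα2 : α ≤ 2) (ht : 0 < t) {E : Set (sector α)}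
    (hE : IsCompact E) {F : sector α → ℂ} (hF : MemLp F 2 (sectorMeasure α t)) :
    MemLp (truncatedInverse α t F E) 2 (dataMeasure α t) := by
  have := isFiniteMeasure_dataMeasure hα ht
  have : IsFiniteMeasure ((sectorMeasure α t).restrict E) :=
    ⟨by simpa using sectorMeasure_lt_top_of_isCompact hα hα2 hE⟩
  obtain ⟨M, hM⟩ := exists_norm_featureFun_le (t := t) hα hα2 hE
  have hFi : Integrable F ((sectorMeasure α t).restrict E) :=
    (hF.restrict E).integrable one_le_two
  have hae : (fun τ => ∫ z in E, F z * featureFun α t z τ ∂sectorMeasure α t)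
      =ᵐ[dataMeasure α t] truncatedInverse α t F E := by
    filter_upwards [ae_dataMeasure_mem α t] with τ hτ
    exact (truncatedInverse_eq hα hα2 F E hτ.2).symm
  refine (memLp_congr_ae hae).1 (MemLp.of_bound
    (C := ∫ z in E, ‖F z‖ * M ∂sectorMeasure α t) ?_ ?_)
  · have h1 : AEStronglyMeasurable (fun p : ℝ × sector α => F p.2 * featureFun α t p.2 p.1)
        ((dataMeasure α t).prod ((sectorMeasure α t).restrict E)) :=
      hFi.1.comp_snd.mul
        ((measurable_featureFun_uncurry α t).comp measurable_swap).aestronglyMeasurable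
    exact h1.integral_prod_right'
  · filter_upwards [ae_dataMeasure_mem α t] with τ hτ
    refine norm_integral_le_of_norm_le (hFi.norm.mul_const M) ?_
    filter_upwards [ae_restrict_mem hE.measurableSet] with z hz
    rw [norm_mul]
    exact mul_le_mul_of_nonneg_left (hM z hz τ hτ) (norm_nonneg _)

theorem toLp_truncatedInverse (hα : 0 < α) (hα2 : α ≤ 2) (ht : 0 < t)
    (U : Lp ℂ 2 (dataMeasure α t) →ₗᵢ[ℂ] Lp ℂ 2 (sectorMeasure α t))
    (hU : ∀ g, U g =ᵐ[sectorMeasure α t] fun z => ⟪featureMap hα hα2 ht z, g⟫_ℂ)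
    {E : Set (sector α)} (hE : IsCompact E) {F : sector α → ℂ}
    (hF : MemLp F 2 (sectorMeasure α t)) :
    (memLp_truncatedInverse hα hα2 ht hE hF).toLp =
      ContinuousLinearMap.adjoint U.toContinuousLinearMap
        (hF.indicator hE.measurableSet).toLp := by
  have := isFiniteMeasure_dataMeasure hα ht
  have : IsFiniteMeasure ((sectorMeasure α t).restrict E) :=
    ⟨by simpa using sectorMeasure_lt_top_of_isCompact hα hα2 hE⟩
  have hFi : Integrable F ((sectorMeasure α t).restrict E) :=
    (hF.restrict E).integrable one_le_two
  obtain ⟨M, hM⟩ := exists_norm_featureFun_le (t := t) hα hα2 hE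
  -- Tested against `g`, the two sides are the two iterated integrals of `F z * conj (g τ) *
  -- featureFun α t z τ` over `E` and the data interval.
  refine ext_inner_left ℂ fun g => ?_
  have hgi : Integrable (fun τ => conj (g τ)) (dataMeasure α t) :=
    Complex.conjCLE.toContinuousLinearMap.integrable_comp ((Lp.memLp g).integrable one_le_two)
  have hleft : ⟪g, (memLp_truncatedInverse hα hα2 ht hE hF).toLp⟫_ℂ =
      ∫ τ, ∫ z in E, F z * conj (g τ) * featureFun α t z τ ∂sectorMeasure α t
        ∂dataMeasure α t := by
    rw [L2.inner_def]
    refine integral_congr_ae ?_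
    filter_upwards [(memLp_truncatedInverse hα hα2 ht hE hF).coeFn_toLp,
      ae_dataMeasure_mem α t] with τ h1 h2
    rw [h1, RCLike.inner_apply, truncatedInverse_eq hα hα2 F E h2.2, ← integral_mul_const]
    simp only [mul_right_comm]
  have hright : ⟪g, ContinuousLinearMap.adjoint U.toContinuousLinearMap
      (hF.indicator hE.measurableSet).toLp⟫_ℂ =
      ∫ z in E, ∫ τ, F z * conj (g τ) * featureFun α t z τ ∂dataMeasure α t
        ∂sectorMeasure α t := by
    rw [ContinuousLinearMap.adjoint_inner_right, L2.inner_def, ← integral_indicator hE.measurableSet]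
    refine integral_congr_ae ?_
    filter_upwards [(hF.indicator hE.measurableSet).coeFn_toLp, hU g] with z h1 h2
    rw [h1, LinearIsometry.coe_toContinuousLinearMap, h2, RCLike.inner_apply]
    by_cases hz : z ∈ E
    · rw [Set.indicator_of_mem hz, Set.indicator_of_mem hz, inner_featureMap,
        ← integral_mul_featureFun, ← integral_conj, ← integral_const_mul]
      simp only [map_mul, Complex.conj_conj, mul_assoc]
    · rw [Set.indicator_of_notMem hz, Set.indicator_of_notMem hz, zero_mul]
  rw [hleft, hright]
  refine (integral_integral_swap ?_).symm
  -- Both measures are finite here, so `F` and `g` are integrable, and the feature function is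
  -- bounded on `E`; this justifies Fubini.
  refine (hFi.mul_prod hgi).mul_bdd (c := M)
    (measurable_featureFun_uncurry α t).aestronglyMeasurable ?_
  filter_upwards [Measure.quasiMeasurePreserving_fst.ae (ae_restrict_mem hE.measurableSet),
    Measure.quasiMeasurePreserving_snd.ae (ae_dataMeasure_mem α t)] with p h1 h2
  exact hM _ h1 _ h2

end Inversion

/-! ### Assembly of the theorem -/

theorem theorem1p2 (α t : ℝ) (hα : 0 < α) (hα2 : α ≤ 2) (ht : 0 < t) :
    -- the integral that defines the operator converges absolutely at every point of the sector
    (∀ (g : Lp ℂ 2 (dataMeasure α t)) (z : sector α),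
      IntegrableOn (operatorIntegrand α t g z) (Set.Ioo 0 t)) ∧
    -- the operator is an isometric linear bijection onto the image space
    ∃ T : Lp ℂ 2 (dataMeasure α t) ≃ₗ[ℂ] imageSpace α t,
      (∀ g : Lp ℂ 2 (dataMeasure α t), (T g : sector α → ℂ) = sectorOperator α t g) ∧
      (∀ g : Lp ℂ 2 (dataMeasure α t), imageNorm α t (T g : sector α → ℂ) = ‖g‖) ∧
      -- the inverse formula, for every compact exhaustion of the sector
      ∀ (F : imageSpace α t) (E : ℕ → Set (sector α)),
        (∀ N, IsCompact (E N)) → Monotone E → (⋃ N, E N) = Set.univ →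
          (∀ N, ∀ τ ∈ Set.Ioo 0 t,
            IntegrableOn (inverseIntegrand α t F τ) (E N) (sectorMeasure α t)) ∧
          ∃ hE : ∀ N, MemLp (truncatedInverse α t F (E N)) 2 (dataMeasure α t),
            Tendsto (fun N => (hE N).toLp (truncatedInverse α t F (E N))) atTop
              (𝓝 (T.symm F)) := by
  refine ⟨fun g z => (integrable_mul_featureFun_iff hα ht g z).1
    (integrable_featureMap hα hα2 ht g z), ?_⟩
  obtain ⟨U, hU⟩ := exists_linearIsometry_featureMap hα hα2 ht
  let T₀ : Lp ℂ 2 (dataMeasure α t) →ₗ[ℂ] imageSpace α t :=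
    { toFun := fun g => ⟨sectorOperator α t g, sectorOperator_mem_imageSpace hα hα2 ht g⟩
      map_add' := fun g g' => Subtype.ext <| funext fun z => by
        simp only [Submodule.coe_add, Pi.add_apply, ← inner_featureMap hα hα2 ht, inner_add_right]
      map_smul' := fun c g => Subtype.ext <| funext fun z => by
        simp only [Submodule.coe_smul, Pi.smul_apply, ← inner_featureMap hα hα2 ht,
          inner_smul_right, RingHom.id_apply, smul_eq_mul] }
  have hinj : Function.Injective T₀ := by
    rw [injective_iff_map_eq_zero]
    intro g hg
    rw [← norm_eq_zero, ← imageNorm_sectorOperator hα hα2 ht g]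
    change imageNorm α t (T₀ g : sector α → ℂ) = 0
    rw [hg, imageNorm_eq_sqrt_integral hα]
    simp
  -- The adjoint of `U` supplies preimages, which gives surjectivity and identifies the inverse at
  -- once.
  have hinv : ∀ (F : imageSpace α t) (hF : MemLp (F : sector α → ℂ) 2 (sectorMeasure α t)),
      T₀ (ContinuousLinearMap.adjoint U.toContinuousLinearMap hF.toLp) = F := by
    intro F hF
    refine Subtype.ext (funext fun z => ?_)
    change sectorOperator α t _ z = (F : sector α → ℂ) z
    rw [← inner_featureMap hα hα2 ht]
    exact inner_adjoint_eq_of_reproducing _ U hU hF z (integral_mul_conj_inner_featureMap hα hα2 ht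
      ((mem_imageSpace_iff hα hα2 _).1 F.2).1 hF z)
  have hmem : ∀ F : imageSpace α t, MemLp (F : sector α → ℂ) 2 (sectorMeasure α t) := fun F =>
    ((mem_imageSpace_iff hα hα2 _).1 F.2).2
  refine ⟨LinearEquiv.ofBijective T₀ ⟨hinj, fun F => ⟨_, hinv F (hmem F)⟩⟩, fun g => rfl,
    fun g => imageNorm_sectorOperator hα hα2 ht g, fun F E hE hmono huniv => ?_⟩
  refine ⟨fun N τ hτ => integrableOn_inverseIntegrand hα hα2 (hE N) (hmem F) hτ,
    fun N => memLp_truncatedInverse hα hα2 ht (hE N) (hmem F), ?_⟩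
  have hsymm : (LinearEquiv.ofBijective T₀ ⟨hinj, fun F => ⟨_, hinv F (hmem F)⟩⟩).symm F =
      ContinuousLinearMap.adjoint U.toContinuousLinearMap (hmem F).toLp :=
    (LinearEquiv.symm_apply_eq _).2 (hinv F (hmem F)).symm
  rw [hsymm]
  simp only [fun N => toLp_truncatedInverse hα hα2 ht U hU (hE N) (hmem F)]
  exact ((ContinuousLinearMap.adjoint U.toContinuousLinearMap).continuous.tendsto _).comp
    (tendsto_toLp_indicator (hmem F) (fun N => (hE N).measurableSet) hmono huniv)
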